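/- **Theorem (quantum de Rham cohomology is supercommutative and associative).** Let $M$ be a smooth ($C^\infty$) manifold of dimension $m$ and let $w$ be a Poisson structure on $M$, i.e. a smooth bivector field whose Schouten–Nijenhuis bracket $[w,w]$ vanishes. Write $w^{ij}=w(e^i,e^j)=-w^{ji}$ for its coefficients in a local frame $e_1,\dots,e_m$ of $TM$ with dual frame $e^1,\dots,e^m$ (so $w=\frac12\sum_{i,j}w^{ij}e_i\wedge e_j$). For a vector $v$ let $v\vdash\alpha=\alpha(v,\cdot,\dots,\cdot)$ and $\alpha\dashv v=\alpha(\cdot,\dots,\cdot,v)$, and let $w\vdash\alpha=\frac12\sum_{i,j}w^{ij}\,e_i\vdash(e_j\vdash\alpha)$. Let $\Omega(M)$ be the space of smooth real differential forms on $M$, $d$ the exterior derivative, and $\delta\alpha=w\vdash d\alpha-d(w\vdash\alpha)$. Let $A$ be either $\mathbb R[h]$ (polynomial case) or $\mathbb R[h,h^{-1}]$ (Laurent case), and $\Omega_A=\Omega(M)\otimes_{\mathbb R}A$. Define on $\Omega_A$ the $A$-linear operator $d_h=d-h\delta$ and the $A$-bilinear product which for $\alpha,\beta\in\Omega(M)$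 is $$\alpha\wedge_h\beta=\sum_{n\ge0}\frac{h^n}{n!}\sum w^{i_1j_1}\cdots w^{i_nj_n}\,(\alpha\dashv e_{i_1}\dashv\cdots\dashv e_{i_n})\wedge(e_{j_n}\vdash\cdots\vdash e_{j_1}\vdash\beta).$$ Give a $q$-form times $h^p$ the degree $q+2p$. Then $d_h^2=0$; put $H_A=\ker d_h/\operatorname{im}d_h$ (so $H_{\mathbb R[h]}=Q_hH^*_{dR}(M)$ is the polynomial and $H_{\mathbb R[h,h^{-1}]}=Q_{h,h^{-1}}H^*_{dR}(M)$ the Laurent quantum de Rham cohomology). In both cases: 1. $\wedge_h$ descends to $H_A$: if $d_h\alpha=0$ and $d_h\beta=0$ then $d_h(\alpha\wedge_h\beta)=0$, and there is a unique $\mathbb R$-bilinear product on $H_A$ with $[\alpha]\wedge_h[\beta]=[\alpha\wedge_h\beta]$ for all $d_h$-closed $\alpha,\beta$. 2. The product is supercommutative: if the classes $a$, $b$ are represented by closed elements that are homogeneous of degrees $|a|$, $|b|$, then $a\wedge_h b=(-1)^{|a||b|}\,b\wedge_h a$. 3. The product is associative: $(a\wedge_h b)\wedge_h c=a\wedge_h(b\wedge_h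 c)$ for all $a,b,c\in H_A$. -/

import Mathlib

open scoped Manifold ContDiff TensorProduct

noncomputable section

namespace QuantumDeRham

section Fibre

variable {k V : Type*} [Field k] [AddCommGroup V] [Module k V]

variable (k V) in
/-- The exterior algebra `Λ(V*)` generated by the dual space `V*`. -/
abbrev Ext : Type _ := ExteriorAlgebra k (Module.Dual k V)

/-- `v ⊢ α`, insertion of `v` in the first slot of `α`. -/
def leftContract (v : V) : Ext k V →ₗ[k] Ext k V :=
  CliffordAlgebra.contractLeft (Module.Dual.eval k V v)

/-- `α ⊣ v`, insertion of `v` in the last slot of `α`. -/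
def rightContract (v : V) : Ext k V →ₗ[k] Ext k V :=
  CliffordAlgebra.contractRight.flip (Module.Dual.eval k V v)

variable {ι : Type*} [Fintype ι]

/-- `α ⊗ β ↦ ∑ i j, wⁱʲ (α ⊣ eᵢ) ⊗ (eⱼ ⊢ β)`, where `e` is a basis of `V` and a bivector `w` is
regarded as a skew bilinear form on `V*`, with coefficients `wⁱʲ = w(eⁱ, eʲ)`. -/
def pairContract (e : Module.Basis ι k V) (w : LinearMap.BilinForm k (Module.Dual k V)) :
    Ext k V ⊗[k] Ext k V →ₗ[k] Ext k V ⊗[k] Ext k V :=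
  ∑ i, ∑ j, w (e.coord i) (e.coord j) •
    TensorProduct.map (rightContract (e i)) (leftContract (e j))

/-- The coefficient of `hⁿ` in the quantum exterior product of `α` and `β`: it is
`(1/n!) ∑ wⁱ¹ʲ¹ ⋯ wⁱⁿʲⁿ (α ⊣ e_{i₁} ⊣ ⋯ ⊣ e_{iₙ}) ∧ (e_{jₙ} ⊢ ⋯ ⊢ e_{j₁} ⊢ β)`. -/
def quantumTerm (e : Module.Basis ι k V) (w : LinearMap.BilinForm k (Module.Dual k V)) (n : ℕ) :
    Ext k V →ₗ[k] Ext k V →ₗ[k] Ext k V :=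
  (n.factorial : k)⁻¹ •
    TensorProduct.curry (LinearMap.mul' k (Ext k V) ∘ₗ (pairContract e w) ^ n)

/-- The contraction `w ⊢ α` with a bivector, normalized by `(u ∧ v) ⊢ α = u ⊢ (v ⊢ α)`, so that
`w ⊢ α = (1/2) ∑ i j, wⁱʲ eᵢ ⊢ (eⱼ ⊢ α)`. -/
def bivectorContract (e : Module.Basis ι k V) (w : LinearMap.BilinForm k (Module.Dual k V)) :
    Ext k V →ₗ[k] Ext k V :=
  (2 : k)⁻¹ • ∑ i, ∑ j, w (e.coord i) (e.coord j) • leftContract (e i) ∘ₗ leftContract (e j)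

variable {V' : Type*} [AddCommGroup V'] [Module k V']

/-- The pull-back `Λ(V'*) → Λ(V*)` along a linear map `V → V'`. -/
def pullExt (L : V →ₗ[k] V') : Ext k V' →ₐ[k] Ext k V := ExteriorAlgebra.map L.dualMap

/-- The bilinear form `(ξ, η) ↦ w(ξ ∘ L, η ∘ L)`: the push-forward of a bivector. -/
def pushBivector (L : V →ₗ[k] V') (w : LinearMap.BilinForm k (Module.Dual k V)) :
    LinearMap.BilinForm k (Module.Dual k V') := w.compl₁₂ L.dualMap L.dualMap

theorem pullExt_ι (L : V →ₗ[k] V') (ξ : Module.Dual k V') :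
    pullExt L (ExteriorAlgebra.ι k ξ) = ExteriorAlgebra.ι k (ξ ∘ₗ L) :=
  ExteriorAlgebra.map_apply_ι _ _

theorem pullExt_algebraMap (L : V →ₗ[k] V') (r : k) :
    pullExt L (algebraMap k (Ext k V') r) = algebraMap k (Ext k V) r := AlgHom.commutes _ _

theorem pullExt_comp {V'' : Type*} [AddCommGroup V''] [Module k V'']
    (L : V →ₗ[k] V') (L' : V' →ₗ[k] V'') (a : Ext k V'') :
    pullExt L (pullExt L' a) = pullExt (L' ∘ₗ L) a := by
  have := ExteriorAlgebra.map_comp_map (R := k) L'.dualMap L.dualMap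
  exact DFunLike.congr_fun this a

theorem pullExt_id (a : Ext k V) : pullExt (LinearMap.id : V →ₗ[k] V) a = a := by
  have := ExteriorAlgebra.map_id (R := k) (M := Module.Dual k V)
  exact DFunLike.congr_fun this a

theorem leftContract_pullExt (L : V →ₗ[k] V') (v : V) (a : Ext k V') :
    leftContract v (pullExt L a) = pullExt L (leftContract (L v) a) := by
  induction a using CliffordAlgebra.left_induction with
  | algebraMap r =>
    have := pullExt_algebraMap L r
    simp only [leftContract] at this ⊢
    erw [this, CliffordAlgebra.contractLeft_algebraMap, CliffordAlgebra.contractLeft_algebraMap]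
    simp
  | add x y hx hy => simp [map_add, hx, hy]
  | ι_mul x m hx =>
    have := pullExt_ι L m
    simp only [ExteriorAlgebra.ι] at this
    simp only [leftContract, map_mul, this, CliffordAlgebra.contractLeft_ι_mul,
      map_sub, map_smul] at hx ⊢
    rw [hx]
    rfl

theorem rightContract_pullExt (L : V →ₗ[k] V') (v : V) (a : Ext k V') :
    rightContract v (pullExt L a) = pullExt L (rightContract (L v) a) := by
  induction a using CliffordAlgebra.right_induction with
  | algebraMap r =>
    have := pullExt_algebraMap L r
    simp only [rightContract, LinearMap.flip_apply] at this ⊢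
    erw [this, CliffordAlgebra.contractRight_algebraMap, CliffordAlgebra.contractRight_algebraMap]
    simp
  | add x y hx hy => simp [map_add, hx, hy]
  | mul_ι m x hx =>
    have := pullExt_ι L m
    simp only [ExteriorAlgebra.ι] at this
    simp only [rightContract, map_mul, this, CliffordAlgebra.contractRight_mul_ι,
      map_sub, map_smul, LinearMap.flip_apply] at hx ⊢
    rw [hx]
    rfl

variable {ι' : Type*} [Fintype ι'] {X : Type*} [AddCommGroup X] [Module k X]

theorem sum_coord_basis_indep (e : Module.Basis ι k V) (f : Module.Basis ι' k V)
    (C : Module.Dual k V →ₗ[k] V →ₗ[k] X) :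
    ∑ i, C (e.coord i) (e i) = ∑ j, C (f.coord j) (f j) := by
  classical
  have h1 : ∀ i, C (e.coord i) (e i) = ∑ j, C (f.coord j (e i) • e.coord i) (f j) := by
    intro i
    calc C (e.coord i) (e i) = C (e.coord i) (∑ j, f.repr (e i) j • f j) := by rw [f.sum_repr]
      _ = _ := by simp only [map_sum, map_smul, LinearMap.smul_apply, Module.Basis.coord_apply]
  have h2 : ∀ j, f.coord j = ∑ i, f.coord j (e i) • e.coord i := by
    intro j
    apply e.ext
    intro l
    simp [LinearMap.sum_apply, Finsupp.single_apply]
  rw [Finset.sum_congr rfl fun i _ => h1 i, Finset.sum_comm]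
  refine Finset.sum_congr rfl fun j _ => ?_
  conv_rhs => rw [h2 j]
  simp [LinearMap.sum_apply]

theorem sum_bivector_basis_indep (e : Module.Basis ι k V) (f : Module.Basis ι' k V)
    (w : LinearMap.BilinForm k (Module.Dual k V)) (B : V →ₗ[k] V →ₗ[k] X) :
    ∑ i, ∑ j, w (e.coord i) (e.coord j) • B (e i) (e j) =
      ∑ i, ∑ j, w (f.coord i) (f.coord j) • B (f i) (f j) := by
  have h1 : ∀ (ξ : Module.Dual k V) (v : V),
      ∑ j, w ξ (e.coord j) • B v (e j) = ∑ j, w ξ (f.coord j) • B v (f j) := fun ξ v =>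
    sum_coord_basis_indep e f ((LinearMap.lsmul k (V →ₗ[k] X)).flip (B v) ∘ₗ w ξ)
  let C : Module.Dual k V →ₗ[k] V →ₗ[k] X := LinearMap.mk₂ k
    (fun ξ v => ∑ j, w ξ (f.coord j) • B v (f j))
    (by intros; simp [add_smul, Finset.sum_add_distrib])
    (by intros; simp [mul_smul, Finset.smul_sum])
    (by intros; simp [smul_add, Finset.sum_add_distrib])
    (by
      intro c ξ v
      simp only [map_smul, LinearMap.smul_apply, Finset.smul_sum]
      exact Finset.sum_congr rfl fun j _ => smul_comm _ _ _)
  rw [Finset.sum_congr rfl fun i _ => h1 (e.coord i) (e i)]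
  exact sum_coord_basis_indep e f C

/-- A contraction with a bivector does not depend on the basis used, and is natural under a linear
isomorphism `L` with inverse `K`. -/
theorem sum_bivector_pull (e : Module.Basis ι k V) (f : Module.Basis ι' k V')
    (L : V →ₗ[k] V') (K : V' →ₗ[k] V) (hLK : L ∘ₗ K = LinearMap.id) (hKL : K ∘ₗ L = LinearMap.id)
    (w : LinearMap.BilinForm k (Module.Dual k V')) (B : V' →ₗ[k] V' →ₗ[k] X) :
    ∑ i, ∑ j, pushBivector K w (e.coord i) (e.coord j) • B (L (e i)) (L (e j)) =
      ∑ i, ∑ j, w (f.coord i) (f.coord j) • B (f i) (f j) := by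
  let E : V ≃ₗ[k] V' := LinearEquiv.ofLinearMap L K hLK hKL
  rw [← sum_bivector_basis_indep (e.map E) f w B]
  rfl

theorem pairContract_pull (e : Module.Basis ι k V) (f : Module.Basis ι' k V')
    (L : V →ₗ[k] V') (K : V' →ₗ[k] V) (hLK : L ∘ₗ K = LinearMap.id) (hKL : K ∘ₗ L = LinearMap.id)
    (w : LinearMap.BilinForm k (Module.Dual k V')) (a : Ext k V' ⊗[k] Ext k V') :
    TensorProduct.map (pullExt L).toLinearMap (pullExt L).toLinearMap (pairContract f w a) =
      pairContract e (pushBivector K w)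
        (TensorProduct.map (pullExt L).toLinearMap (pullExt L).toLinearMap a) := by
  induction a using TensorProduct.induction_on with
  | zero => simp
  | add x y hx hy => simp only [map_add, hx, hy]
  | tmul x y =>
    have := sum_bivector_pull e f L K hLK hKL w (LinearMap.mk₂ k
      (fun u v => pullExt L (rightContract u x) ⊗ₜ[k] pullExt L (leftContract v y))
      (by intros; simp [rightContract, TensorProduct.add_tmul])
      (by intros; simp [rightContract, TensorProduct.smul_tmul'])
      (by intros; simp [leftContract, TensorProduct.tmul_add])
      (by intros; simp [leftContract]))
    simp only [pairContract, LinearMap.sum_apply, LinearMap.smul_apply, map_sum, map_smul,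
      TensorProduct.map_tmul, AlgHom.toLinearMap_apply, leftContract_pullExt, rightContract_pullExt]
    exact this.symm

theorem quantumTerm_pull (e : Module.Basis ι k V) (f : Module.Basis ι' k V')
    (L : V →ₗ[k] V') (K : V' →ₗ[k] V) (hLK : L ∘ₗ K = LinearMap.id) (hKL : K ∘ₗ L = LinearMap.id)
    (w : LinearMap.BilinForm k (Module.Dual k V')) (n : ℕ) (a b : Ext k V') :
    pullExt L (quantumTerm f w n a b) =
      quantumTerm e (pushBivector K w) n (pullExt L a) (pullExt L b) := by
  have h : ∀ c : Ext k V' ⊗[k] Ext k V',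
      TensorProduct.map (pullExt L).toLinearMap (pullExt L).toLinearMap
        ((pairContract f w ^ n) c) = (pairContract e (pushBivector K w) ^ n)
        (TensorProduct.map (pullExt L).toLinearMap (pullExt L).toLinearMap c) := by
    induction n with
    | zero => simp
    | succ n ih => intro c; rw [pow_succ', pow_succ', Module.End.mul_apply, Module.End.mul_apply,
        pairContract_pull e f L K hLK hKL, ih]
  have hm : ∀ c : Ext k V' ⊗[k] Ext k V', pullExt L (LinearMap.mul' k _ c) =
      LinearMap.mul' k _
        (TensorProduct.map (pullExt L).toLinearMap (pullExt L).toLinearMap c) := by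
    intro c
    induction c using TensorProduct.induction_on with
    | zero => simp
    | add x y hx hy => simp only [map_add, hx, hy]
    | tmul x y => simp
  simp [quantumTerm, hm, h]

theorem bivectorContract_pull (e : Module.Basis ι k V) (f : Module.Basis ι' k V')
    (L : V →ₗ[k] V') (K : V' →ₗ[k] V) (hLK : L ∘ₗ K = LinearMap.id) (hKL : K ∘ₗ L = LinearMap.id)
    (w : LinearMap.BilinForm k (Module.Dual k V')) (a : Ext k V') :
    pullExt L (bivectorContract f w a) =
      bivectorContract e (pushBivector K w) (pullExt L a) := by
  have := sum_bivector_pull e f L K hLK hKL w (LinearMap.mk₂ k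
      (fun u v => pullExt L (leftContract u (leftContract v a)))
      (by intros; simp [leftContract])
      (by intros; simp [leftContract])
      (by intros; simp [leftContract])
      (by intros; simp [leftContract]))
  simp only [bivectorContract, LinearMap.sum_apply, LinearMap.smul_apply, map_sum, map_smul,
    LinearMap.comp_apply, leftContract_pullExt]
  exact congrArg _ this.symm

end Fibre

section Coordinates

variable {E : Type*} [NormedAddCommGroup E] [NormedSpace ℝ E]
variable {W W' : Type*} [AddCommGroup W] [Module ℝ W] [AddCommGroup W'] [Module ℝ W']

/-- Smoothness on `U` of a function with values in a finite dimensional space `W` on which no norm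
has been chosen: all its components are smooth. -/
def SmoothOn (F : E → W) (U : Set E) : Prop :=
  ∀ ℓ : Module.Dual ℝ W, ContDiffOn ℝ ∞ (fun y => ℓ (F y)) U

theorem SmoothOn.zero (U : Set E) : SmoothOn (fun _ : E => (0 : W)) U := fun ℓ => by
  simpa using contDiffOn_const

theorem SmoothOn.add {F G : E → W} {U : Set E} (hF : SmoothOn F U) (hG : SmoothOn G U) :
    SmoothOn (fun y => F y + G y) U := fun ℓ => by
  simpa using (hF ℓ).add (hG ℓ)

theorem SmoothOn.sum {κ : Type*} (s : Finset κ) {F : κ → E → W} {U : Set E}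
    (hF : ∀ i ∈ s, SmoothOn (F i) U) : SmoothOn (fun y => ∑ i ∈ s, F i y) U := fun ℓ => by
  simp only [map_sum]
  exact ContDiffOn.sum fun i hi => hF i hi ℓ

theorem SmoothOn.smul {f : E → ℝ} {F : E → W} {U : Set E} (hf : ContDiffOn ℝ ∞ f U)
    (hF : SmoothOn F U) : SmoothOn (fun y => f y • F y) U := fun ℓ => by
  simpa using hf.mul (hF ℓ)

theorem SmoothOn.linear {F : E → W} {U : Set E} (hF : SmoothOn F U) (T : W →ₗ[ℝ] W') :
    SmoothOn (fun y => T (F y)) U := fun ℓ => hF (ℓ ∘ₗ T)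

theorem SmoothOn.congr {F G : E → W} {U : Set E} (hF : SmoothOn F U)
    (h : ∀ y ∈ U, G y = F y) : SmoothOn G U := fun ℓ =>
  (hF ℓ).congr fun y hy => by rw [h y hy]

theorem SmoothOn.const (a : W) (U : Set E) : SmoothOn (fun _ : E => a) U :=
  fun _ => contDiffOn_const

theorem SmoothOn.tmul {κ κ' : Type*} [Fintype κ] [Fintype κ'] (b : Module.Basis κ ℝ W)
    (b' : Module.Basis κ' ℝ W') {F : E → W} {G : E → W'} {U : Set E} (hF : SmoothOn F U)
    (hG : SmoothOn G U) : SmoothOn (fun y => F y ⊗ₜ[ℝ] G y) U := by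
  have h : ∀ y, F y ⊗ₜ[ℝ] G y =
      ∑ i, ∑ j, (b.coord i (F y) * b'.coord j (G y)) • (b i ⊗ₜ[ℝ] b' j) := by
    intro y
    conv_lhs => rw [← b.sum_repr (F y), ← b'.sum_repr (G y)]
    simp only [TensorProduct.sum_tmul, TensorProduct.tmul_sum, TensorProduct.smul_tmul_smul]
    exact Finset.sum_comm
  simp only [h]
  exact SmoothOn.sum _ fun i _ => SmoothOn.sum _ fun j _ =>
    SmoothOn.smul ((hF _).mul (hG _)) (SmoothOn.const _ _)

variable (m : ℕ)

/-- The standard basis `e₁, …, e_m` of Euclidean space; its dual basis is `dx¹, …, dxᵐ`. -/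
def stdBasis : Module.Basis (Fin m) ℝ (EuclideanSpace ℝ (Fin m)) :=
  (EuclideanSpace.basisFun (Fin m) ℝ).toBasis

/-- The basis of `Λ((ℝᵐ)*)` formed by the products `dx^I`. -/
def formBasis : Module.Basis (Finset (Fin m)) ℝ (Ext ℝ (EuclideanSpace ℝ (Fin m))) :=
  (stdBasis m).dualBasis.ExteriorAlgebra

variable {m}

/-- The covector `dxⁱ`, as an element of the exterior algebra. -/
def dx (i : Fin m) : Ext ℝ (EuclideanSpace ℝ (Fin m)) :=
  ExteriorAlgebra.ι ℝ ((stdBasis m).coord i)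

/-- The partial derivative `∂F/∂xⁱ` of a form on `ℝᵐ`, computed component by component. -/
def partialD (i : Fin m) (F : EuclideanSpace ℝ (Fin m) → Ext ℝ (EuclideanSpace ℝ (Fin m)))
    (y : EuclideanSpace ℝ (Fin m)) : Ext ℝ (EuclideanSpace ℝ (Fin m)) :=
  ∑ I, fderiv ℝ (fun z => (formBasis m).coord I (F z)) y (stdBasis m i) • formBasis m I

/-- The exterior derivative `dF = ∑ dxⁱ ∧ ∂F/∂xⁱ` of a form on `ℝᵐ`. -/
def extD (F : EuclideanSpace ℝ (Fin m) → Ext ℝ (EuclideanSpace ℝ (Fin m)))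
    (y : EuclideanSpace ℝ (Fin m)) : Ext ℝ (EuclideanSpace ℝ (Fin m)) :=
  ∑ i, dx i * partialD i F y

/-- The components of `F` are differentiable at `y`. -/
def DiffAt (F : EuclideanSpace ℝ (Fin m) → Ext ℝ (EuclideanSpace ℝ (Fin m)))
    (y : EuclideanSpace ℝ (Fin m)) : Prop :=
  ∀ I, DifferentiableAt ℝ (fun z => (formBasis m).coord I (F z)) y

variable {F G : EuclideanSpace ℝ (Fin m) → Ext ℝ (EuclideanSpace ℝ (Fin m))}
  {y : EuclideanSpace ℝ (Fin m)}

theorem coord_partialD (i : Fin m) (I : Finset (Fin m)) :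
    (formBasis m).coord I (partialD i F y) =
      fderiv ℝ (fun z => (formBasis m).coord I (F z)) y (stdBasis m i) := by
  classical
  simp [partialD, Finsupp.single_apply]

theorem partialD_congr (h : F =ᶠ[nhds y] G) (i : Fin m) : partialD i F y = partialD i G y := by
  unfold partialD
  refine Finset.sum_congr rfl fun I _ => ?_
  have : (fun z => (formBasis m).coord I (F z)) =ᶠ[nhds y]
      fun z => (formBasis m).coord I (G z) := h.mono fun z hz => by simp only [hz]
  rw [this.fderiv_eq]

theorem extD_congr (h : F =ᶠ[nhds y] G) : extD F y = extD G y := by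
  simp only [extD, partialD_congr h]

theorem DiffAt.add (hF : DiffAt F y) (hG : DiffAt G y) : DiffAt (fun z => F z + G z) y :=
  fun I => by simpa only [map_add] using (hF I).fun_add (hG I)

theorem partialD_add (hF : DiffAt F y) (hG : DiffAt G y) (i : Fin m) :
    partialD i (fun z => F z + G z) y = partialD i F y + partialD i G y := by
  simp only [partialD, map_add, ← Finset.sum_add_distrib, ← add_smul]
  refine Finset.sum_congr rfl fun I _ => ?_
  rw [fderiv_fun_add (hF I) (hG I)]
  rfl

theorem extD_add (hF : DiffAt F y) (hG : DiffAt G y) :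
    extD (fun z => F z + G z) y = extD F y + extD G y := by
  simp only [extD, partialD_add hF hG, mul_add, Finset.sum_add_distrib]

theorem coord_mul (I : Finset (Fin m)) (a b : Ext ℝ (EuclideanSpace ℝ (Fin m))) :
    (formBasis m).coord I (a * b) = ∑ J, ∑ K, (formBasis m).coord J a * (formBasis m).coord K b *
      (formBasis m).coord I (formBasis m J * formBasis m K) := by
  conv_lhs => rw [← (formBasis m).sum_repr a, ← (formBasis m).sum_repr b]
  simp only [Finset.sum_mul, Finset.mul_sum, map_sum, smul_mul_smul_comm, map_smul, smul_eq_mul,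
    Module.Basis.coord_apply]
  rw [Finset.sum_comm]

theorem DiffAt.mul (hF : DiffAt F y) (hG : DiffAt G y) : DiffAt (fun z => F z * G z) y := by
  intro I
  rw [show (fun z => (formBasis m).coord I (F z * G z)) = _ from
    funext fun z => coord_mul I (F z) (G z)]
  exact DifferentiableAt.fun_sum fun J _ => DifferentiableAt.fun_sum fun K _ =>
    ((hF J).fun_mul (hG K)).mul_const _

theorem partialD_mul (hF : DiffAt F y) (hG : DiffAt G y) (i : Fin m) :
    partialD i (fun z => F z * G z) y = partialD i F y * G y + F y * partialD i G y := by
  apply (formBasis m).ext_elem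
  intro I
  have h := coord_partialD (F := fun z => F z * G z) (y := y) i I
  rw [Module.Basis.coord_apply] at h
  rw [h, ← Module.Basis.coord_apply, map_add, coord_mul I (partialD i F y), coord_mul I (F y),
    show (fun z => (formBasis m).coord I (F z * G z)) = _ from
      funext fun z => coord_mul I (F z) (G z)]
  simp only [coord_partialD]
  rw [fderiv_fun_sum fun J _ => DifferentiableAt.fun_sum fun K _ =>
    ((hF J).fun_mul (hG K)).mul_const _]
  simp only [sum_apply, ← Finset.sum_add_distrib]
  refine Finset.sum_congr rfl fun J _ => ?_
  rw [fderiv_fun_sum fun K _ => ((hF J).fun_mul (hG K)).mul_const _]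
  simp only [sum_apply]
  refine Finset.sum_congr rfl fun K _ => ?_
  rw [fderiv_mul_const ((hF J).fun_mul (hG K)), fderiv_fun_mul (hF J) (hG K)]
  simp only [smul_apply, add_apply, smul_eq_mul]
  ring

theorem ι_mul_eq_involute_mul (ξ : Module.Dual ℝ (EuclideanSpace ℝ (Fin m)))
    (a : Ext ℝ (EuclideanSpace ℝ (Fin m))) :
    ExteriorAlgebra.ι ℝ ξ * a = CliffordAlgebra.involute a * ExteriorAlgebra.ι ℝ ξ := by
  induction a using ExteriorAlgebra.induction with
  | algebraMap r => rw [AlgHom.commutes, Algebra.commutes]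
  | ι η =>
    have h := ExteriorAlgebra.ι_add_mul_swap (R := ℝ) ξ η
    have h' : CliffordAlgebra.involute (ExteriorAlgebra.ι ℝ η) = -ExteriorAlgebra.ι ℝ η :=
      CliffordAlgebra.involute_ι _
    rw [h', neg_mul]
    exact eq_neg_of_add_eq_zero_left h
  | mul a b ha hb => rw [map_mul, ← mul_assoc, ha, mul_assoc, hb, mul_assoc]
  | add a b ha hb => rw [map_add, mul_add, add_mul, ha, hb]

theorem extD_mul (hF : DiffAt F y) (hG : DiffAt G y) :
    extD (fun z => F z * G z) y =
      extD F y * G y + CliffordAlgebra.involute (F y) * extD G y := by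
  simp only [extD, partialD_mul hF hG, mul_add, Finset.sum_add_distrib, Finset.sum_mul,
    Finset.mul_sum, ← mul_assoc]
  congr 1
  refine Finset.sum_congr rfl fun i _ => ?_
  rw [dx, ι_mul_eq_involute_mul]

theorem diffAt_const (a : Ext ℝ (EuclideanSpace ℝ (Fin m))) : DiffAt (fun _ => a) y :=
  fun _ => differentiableAt_const _

theorem partialD_const (i : Fin m) (a : Ext ℝ (EuclideanSpace ℝ (Fin m))) :
    partialD i (fun _ => a) y = 0 := by
  simp [partialD]

theorem extD_const (a : Ext ℝ (EuclideanSpace ℝ (Fin m))) : extD (fun _ => a) y = 0 := by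
  simp [extD, partialD_const]

theorem DiffAt.smul_const {f : EuclideanSpace ℝ (Fin m) → ℝ} (hf : DifferentiableAt ℝ f y)
    (a : Ext ℝ (EuclideanSpace ℝ (Fin m))) : DiffAt (fun z => f z • a) y := fun I => by
  simpa only [map_smul, smul_eq_mul] using hf.mul_const _

theorem partialD_smul_const {f : EuclideanSpace ℝ (Fin m) → ℝ} (hf : DifferentiableAt ℝ f y)
    (i : Fin m) (a : Ext ℝ (EuclideanSpace ℝ (Fin m))) :
    partialD i (fun z => f z • a) y = fderiv ℝ f y (stdBasis m i) • a := by
  conv_rhs => rw [← (formBasis m).sum_repr a, Finset.smul_sum]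
  refine Finset.sum_congr rfl fun I _ => ?_
  simp only [map_smul, smul_eq_mul, smul_smul]
  rw [fderiv_mul_const hf]
  simp [mul_comm]

theorem extD_smul_const {f : EuclideanSpace ℝ (Fin m) → ℝ} (hf : DifferentiableAt ℝ f y)
    (a : Ext ℝ (EuclideanSpace ℝ (Fin m))) :
    extD (fun z => f z • a) y = ExteriorAlgebra.ι ℝ (fderiv ℝ f y : _ →ₗ[ℝ] ℝ) * a := by
  have h : (fderiv ℝ f y : EuclideanSpace ℝ (Fin m) →ₗ[ℝ] ℝ) =
      ∑ i, fderiv ℝ f y (stdBasis m i) • (stdBasis m).coord i := by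
    classical
    apply (stdBasis m).ext
    intro j
    simp [LinearMap.sum_apply, Finsupp.single_apply]
  simp only [extD, partialD_smul_const hf, h, map_sum, map_smul, Finset.sum_mul, smul_mul_assoc,
    mul_smul_comm, dx]

theorem DiffAt.sum {κ : Type*} (s : Finset κ)
    {H : κ → EuclideanSpace ℝ (Fin m) → Ext ℝ (EuclideanSpace ℝ (Fin m))}
    (hH : ∀ j ∈ s, DiffAt (H j) y) : DiffAt (fun z => ∑ j ∈ s, H j z) y := fun I => by
  simp only [map_sum]
  exact DifferentiableAt.fun_sum fun j hj => hH j hj I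

theorem extD_sum {κ : Type*} (s : Finset κ)
    {H : κ → EuclideanSpace ℝ (Fin m) → Ext ℝ (EuclideanSpace ℝ (Fin m))}
    (hH : ∀ j ∈ s, DiffAt (H j) y) :
    extD (fun z => ∑ j ∈ s, H j z) y = ∑ j ∈ s, extD (H j) y := by
  classical
  induction s using Finset.induction_on with
  | empty => simpa using extD_const (y := y) 0
  | insert a s ha ih =>
    simp only [Finset.sum_insert ha]
    rw [extD_add (hH a (Finset.mem_insert_self _ _))
      (DiffAt.sum s fun j hj => hH j (Finset.mem_insert_of_mem hj)),
      ih fun j hj => hH j (Finset.mem_insert_of_mem hj)]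

/-- The pull-back of a constant form along a smooth map is differentiable and closed. -/
theorem extD_pullExt_const {τ : EuclideanSpace ℝ (Fin m) → EuclideanSpace ℝ (Fin m)}
    (hτ : ContDiffAt ℝ ∞ τ y) (a : Ext ℝ (EuclideanSpace ℝ (Fin m))) :
    DiffAt (fun z => pullExt (fderiv ℝ τ z : _ →ₗ[ℝ] _) a) y ∧
      extD (fun z => pullExt (fderiv ℝ τ z : _ →ₗ[ℝ] _) a) y = 0 := by
  induction a using ExteriorAlgebra.induction with
  | algebraMap r =>
    have h : (fun z => pullExt (fderiv ℝ τ z : EuclideanSpace ℝ (Fin m) →ₗ[ℝ] _)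
        (algebraMap ℝ (Ext ℝ (EuclideanSpace ℝ (Fin m))) r)) = fun _ => algebraMap ℝ _ r := by
      funext z; exact pullExt_algebraMap _ _
    rw [h]
    exact ⟨diffAt_const _, extD_const _⟩
  | ι ξ =>
    let ξc : EuclideanSpace ℝ (Fin m) →L[ℝ] ℝ := LinearMap.toContinuousLinearMap ξ
    have hd : DifferentiableAt ℝ (fderiv ℝ τ) y :=
      (hτ.fderiv_right (m := 1) (by norm_cast)).differentiableAt (by norm_num)
    have hg : ∀ j, DifferentiableAt ℝ (fun z => ξc (fderiv ℝ τ z (stdBasis m j))) y := fun j =>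
      ξc.differentiableAt.comp y (hd.clm_apply (differentiableAt_const _))
    have h : (fun z => pullExt (fderiv ℝ τ z : EuclideanSpace ℝ (Fin m) →ₗ[ℝ] _)
        (ExteriorAlgebra.ι ℝ ξ)) =
        fun z => ∑ j, ξc (fderiv ℝ τ z (stdBasis m j)) • dx j := by
      funext z
      rw [pullExt_ι]
      have : ξ ∘ₗ (fderiv ℝ τ z : EuclideanSpace ℝ (Fin m) →ₗ[ℝ] _) =
          ∑ j, ξc (fderiv ℝ τ z (stdBasis m j)) • (stdBasis m).coord j := by
        classical
        apply (stdBasis m).ext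
        intro l
        simp [LinearMap.sum_apply, Finsupp.single_apply, ξc]
      rw [this]
      simp only [map_sum, map_smul, dx]
    rw [h]
    refine ⟨DiffAt.sum _ fun j _ => DiffAt.smul_const (hg j) _, ?_⟩
    rw [extD_sum _ fun j _ => DiffAt.smul_const (hg j) _]
    simp only [extD, partialD_smul_const (hg _)]
    have hsymm : ∀ i j, fderiv ℝ (fun z => ξc (fderiv ℝ τ z (stdBasis m j))) y (stdBasis m i) =
        fderiv ℝ (fun z => ξc (fderiv ℝ τ z (stdBasis m i))) y (stdBasis m j) := by
      have hf : ∀ i j, fderiv ℝ (fun z => ξc (fderiv ℝ τ z (stdBasis m j))) y (stdBasis m i) =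
          ξc (fderiv ℝ (fderiv ℝ τ) y (stdBasis m i) (stdBasis m j)) := by
        intro i j
        have h1 : HasFDerivAt (fun z => fderiv ℝ τ z (stdBasis m j))
            ((fderiv ℝ (fderiv ℝ τ) y).flip (stdBasis m j)) y := by
          simpa using hd.hasFDerivAt.clm_apply (hasFDerivAt_const (stdBasis m j) y)
        have h2 := ξc.hasFDerivAt.comp y h1
        have h3 : fderiv ℝ (fun z => ξc (fderiv ℝ τ z (stdBasis m j))) y = _ := h2.fderiv
        rw [h3]
        rfl
      intro i j
      rw [hf, hf]
      have hs : IsSymmSndFDerivAt ℝ τ y := hτ.isSymmSndFDerivAt (by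
        rw [minSmoothness_of_isRCLikeNormedField]
        exact WithTop.coe_le_coe.mpr le_top)
      rw [hs.eq]
    have key : ∑ j, ∑ i, dx i * (fderiv ℝ (fun z => ξc (fderiv ℝ τ z (stdBasis m j))) y
        (stdBasis m i) • dx j) = -∑ j, ∑ i, dx i * (fderiv ℝ (fun z => ξc (fderiv ℝ τ z
          (stdBasis m j))) y (stdBasis m i) • dx j) := by
      conv_lhs => rw [Finset.sum_comm]
      rw [← Finset.sum_neg_distrib]
      refine Finset.sum_congr rfl fun i _ => ?_
      rw [← Finset.sum_neg_distrib]
      refine Finset.sum_congr rfl fun j _ => ?_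
      have h := ExteriorAlgebra.ι_add_mul_swap (R := ℝ) ((stdBasis m).coord i)
        ((stdBasis m).coord j)
      rw [hsymm i j, mul_smul_comm, mul_smul_comm, ← smul_neg]
      congr 1
      exact eq_neg_of_add_eq_zero_left h
    have h2 := add_eq_zero_iff_eq_neg.mpr key
    rw [← two_smul ℝ] at h2
    exact (smul_eq_zero.mp h2).resolve_left two_ne_zero
  | mul a b ha hb =>
    simp only [map_mul]
    refine ⟨ha.1.mul hb.1, ?_⟩
    rw [extD_mul ha.1 hb.1, ha.2, hb.2]
    simp
  | add a b ha hb =>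
    simp only [map_add]
    refine ⟨ha.1.add hb.1, ?_⟩
    rw [extD_add ha.1 hb.1, ha.2, hb.2, add_zero]

/-- The exterior derivative commutes with pull-back along smooth maps. -/
theorem extD_pullExt {τ : EuclideanSpace ℝ (Fin m) → EuclideanSpace ℝ (Fin m)}
    (hτ : ContDiffAt ℝ ∞ τ y) (hF : DiffAt F (τ y)) :
    extD (fun z => pullExt (fderiv ℝ τ z : _ →ₗ[ℝ] _) (F (τ z))) y =
      pullExt (fderiv ℝ τ y : _ →ₗ[ℝ] _) (extD F (τ y)) := by
  have hτ1 : DifferentiableAt ℝ τ y := hτ.differentiableAt (by simp)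
  have hc : ∀ I, DifferentiableAt ℝ (fun z => (formBasis m).coord I (F (τ z))) y := fun I =>
    (hF I).comp y hτ1
  have hone : ∀ I, DiffAt (fun z => ((formBasis m).coord I (F (τ z))) •
      (1 : Ext ℝ (EuclideanSpace ℝ (Fin m)))) y := fun I => DiffAt.smul_const (hc I) _
  have h : (fun z => pullExt (fderiv ℝ τ z : EuclideanSpace ℝ (Fin m) →ₗ[ℝ] _) (F (τ z))) =
      fun z => ∑ I, (((formBasis m).coord I (F (τ z))) • (1 : Ext ℝ (EuclideanSpace ℝ (Fin m)))) *
        pullExt (fderiv ℝ τ z : EuclideanSpace ℝ (Fin m) →ₗ[ℝ] _) (formBasis m I) := by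
    funext z
    conv_lhs => rw [← (formBasis m).sum_repr (F (τ z))]
    simp only [map_sum, map_smul, smul_mul_assoc, one_mul, Module.Basis.coord_apply]
  have hF' : F = fun z => ∑ I, (formBasis m).coord I (F z) • formBasis m I := by
    funext z
    exact ((formBasis m).sum_repr (F z)).symm
  have hr : extD F (τ y) = ∑ I, ExteriorAlgebra.ι ℝ
      (fderiv ℝ (fun z => (formBasis m).coord I (F z)) (τ y) : _ →ₗ[ℝ] ℝ) * formBasis m I := by
    conv_lhs => rw [hF']
    rw [extD_sum _ fun I _ => DiffAt.smul_const (hF I) _]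
    exact Finset.sum_congr rfl fun I _ => extD_smul_const (hF I) _
  rw [h, extD_sum _ fun I _ => (hone I).mul (extD_pullExt_const hτ _).1, hr, map_sum]
  refine Finset.sum_congr rfl fun I _ => ?_
  rw [extD_mul (hone I) (extD_pullExt_const hτ _).1, (extD_pullExt_const hτ _).2, mul_zero,
    add_zero, extD_smul_const (hc I), mul_one, map_mul, pullExt_ι]
  have : fderiv ℝ (fun z => (formBasis m).coord I (F (τ z))) y =
      (fderiv ℝ (fun z => (formBasis m).coord I (F z)) (τ y)).comp (fderiv ℝ τ y) :=
    fderiv_comp (g := fun z => (formBasis m).coord I (F z)) y (hF I) hτ1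
  rw [this]
  rfl

theorem SmoothOn.diffAt {U : Set (EuclideanSpace ℝ (Fin m))} (hU : IsOpen U) (hF : SmoothOn F U)
    (hy : y ∈ U) : DiffAt F y := fun I =>
  ((hF ((formBasis m).coord I)).contDiffAt (hU.mem_nhds hy)).differentiableAt (by simp)

theorem SmoothOn.extD {U : Set (EuclideanSpace ℝ (Fin m))} (hU : IsOpen U) (hF : SmoothOn F U) :
    SmoothOn (QuantumDeRham.extD F) U := by
  refine SmoothOn.sum _ fun i _ => SmoothOn.linear (T := LinearMap.mulLeft ℝ (dx i)) ?_
  refine SmoothOn.sum _ fun I _ => SmoothOn.smul ?_ (SmoothOn.const _ _)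
  exact ((hF _).fderiv_of_isOpen hU (by simp)).clm_apply contDiffOn_const

theorem SmoothOn.quantumTerm
    {P : EuclideanSpace ℝ (Fin m) → LinearMap.BilinForm ℝ (Module.Dual ℝ (EuclideanSpace ℝ (Fin m)))}
    {U : Set (EuclideanSpace ℝ (Fin m))} (hP : SmoothOn P U) (hF : SmoothOn F U)
    (hG : SmoothOn G U) (n : ℕ) :
    SmoothOn (fun z => QuantumDeRham.quantumTerm (stdBasis m) (P z) n (F z) (G z)) U := by
  refine SmoothOn.smul (f := fun _ => (n.factorial : ℝ)⁻¹) contDiffOn_const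
    (SmoothOn.linear (T := LinearMap.mul' ℝ _)
      (F := fun z => (pairContract (stdBasis m) (P z) ^ n) (F z ⊗ₜ[ℝ] G z)) ?_)
  induction n with
  | zero => simpa using SmoothOn.tmul (formBasis m) (formBasis m) hF hG
  | succ n ih =>
    simp only [pow_succ', Module.End.mul_apply]
    simp only [pairContract, LinearMap.sum_apply, LinearMap.smul_apply] at ih ⊢
    exact SmoothOn.sum _ fun i _ => SmoothOn.sum _ fun j _ => SmoothOn.smul
      (hP (LinearMap.applyₗ ((stdBasis m).coord j) ∘ₗ LinearMap.applyₗ ((stdBasis m).coord i)))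
      (SmoothOn.linear ih _)

theorem SmoothOn.bivectorContract
    {P : EuclideanSpace ℝ (Fin m) → LinearMap.BilinForm ℝ (Module.Dual ℝ (EuclideanSpace ℝ (Fin m)))}
    {U : Set (EuclideanSpace ℝ (Fin m))} (hP : SmoothOn P U) (hF : SmoothOn F U) :
    SmoothOn (fun z => QuantumDeRham.bivectorContract (stdBasis m) (P z) (F z)) U := by
  simp only [QuantumDeRham.bivectorContract, LinearMap.sum_apply, LinearMap.smul_apply]
  exact SmoothOn.smul (f := fun _ => (2 : ℝ)⁻¹) contDiffOn_const
    (SmoothOn.sum _ fun i _ => SmoothOn.sum _ fun j _ => SmoothOn.smul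
      (hP (LinearMap.applyₗ ((stdBasis m).coord j) ∘ₗ LinearMap.applyₗ ((stdBasis m).coord i)))
      (SmoothOn.linear hF _))

end Coordinates

section Manifold

variable (m : ℕ) (M : Type*) [TopologicalSpace M] [ChartedSpace (EuclideanSpace ℝ (Fin m)) M]
  [IsManifold (𝓡 m) ∞ M]

/-- `Λ(T*ₓM)`. -/
abbrev ExtAt {M : Type*} [TopologicalSpace M] [ChartedSpace (EuclideanSpace ℝ (Fin m)) M]
    (x : M) : Type _ := Ext ℝ (TangentSpace (𝓡 m) x)

/-- A basis of `TₓM`: the coordinate vectors of the preferred chart at `x`. -/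
def tangentBasis {M : Type*} [TopologicalSpace M] [ChartedSpace (EuclideanSpace ℝ (Fin m)) M]
    (x : M) : Module.Basis (Fin m) ℝ (TangentSpace (𝓡 m) x) := stdBasis m

variable {M}

/-- The derivative at `q` of the chart around `x₀`, a linear map `T_qM → ℝᵐ`. -/
def coordDeriv (x₀ q : M) : TangentSpace (𝓡 m) q →ₗ[ℝ] EuclideanSpace ℝ (Fin m) :=
  ((trivializationAt (EuclideanSpace ℝ (Fin m)) (TangentSpace (𝓡 m)) x₀).continuousLinearMapAt
    ℝ q : TangentSpace (𝓡 m) q →L[ℝ] EuclideanSpace ℝ (Fin m))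

/-- The derivative of the inverse of the chart around `x₀`, a linear map `ℝᵐ → T_qM`; here `q`
lies in the domain of the chart. -/
def coordFrame (x₀ q : M) : EuclideanSpace ℝ (Fin m) →ₗ[ℝ] TangentSpace (𝓡 m) q :=
  ((trivializationAt (EuclideanSpace ℝ (Fin m)) (TangentSpace (𝓡 m)) x₀).symmL
    ℝ q : EuclideanSpace ℝ (Fin m) →L[ℝ] TangentSpace (𝓡 m) q)

/-- The expression of `θ` in the chart around `x₀`: its pull-back along the inverse of the
chart. -/
def localForm (θ : ∀ x : M, ExtAt m x) (x₀ : M) (y : EuclideanSpace ℝ (Fin m)) :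
    Ext ℝ (EuclideanSpace ℝ (Fin m)) :=
  pullExt (coordFrame m x₀ ((extChartAt (𝓡 m) x₀).symm y)) (θ ((extChartAt (𝓡 m) x₀).symm y))

/-- The expression in the chart around `x₀` of a field of bilinear forms on the cotangent spaces:
its push-forward along the chart, with coefficients `w(dxⁱ, dxʲ)`. -/
def localBivector (w : ∀ x : M, LinearMap.BilinForm ℝ (Module.Dual ℝ (TangentSpace (𝓡 m) x)))
    (x₀ : M) (y : EuclideanSpace ℝ (Fin m)) :
    LinearMap.BilinForm ℝ (Module.Dual ℝ (EuclideanSpace ℝ (Fin m))) :=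
  pushBivector (coordDeriv m x₀ ((extChartAt (𝓡 m) x₀).symm y))
    (w ((extChartAt (𝓡 m) x₀).symm y))

variable (M) in
/-- The smooth sections of `Λ(T*M)`. -/
def smoothForms : Submodule ℝ (∀ x : M, ExtAt m x) where
  carrier := {θ | ∀ x₀, SmoothOn (localForm m θ x₀) (extChartAt (𝓡 m) x₀).target}
  zero_mem' _ := (SmoothOn.zero _).congr fun _ _ => map_zero (pullExt _)
  add_mem' ha hb x₀ := ((ha x₀).add (hb x₀)).congr fun _ _ => map_add (pullExt _) _ _
  smul_mem' c _ ha x₀ := (SmoothOn.smul (f := fun _ => c) contDiffOn_const (ha x₀)).congr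
    fun _ _ => map_smul (pullExt _) _ _

variable (M) in
/-- `Ω(M)`: the space of smooth differential forms, of all degrees. -/
def Form : Type _ := smoothForms m M

instance : AddCommGroup (Form m M) := inferInstanceAs (AddCommGroup (smoothForms m M))

instance : Module ℝ (Form m M) := inferInstanceAs (Module ℝ (smoothForms m M))

variable (M) in
/-- A smooth bivector field, that is, a smooth field of skew bilinear forms on the cotangent
spaces. -/
structure BivectorField where
  /-- The bivector at a point. -/
  toFun : ∀ x : M, LinearMap.BilinForm ℝ (Module.Dual ℝ (TangentSpace (𝓡 m) x))
  isAlt : ∀ x, (toFun x).IsAlt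
  smooth : ∀ x₀, SmoothOn (localBivector m toFun x₀) (extChartAt (𝓡 m) x₀).target

variable {m}

/-- The coefficient `wⁱʲ` of a bivector field in the chart around `x₀`. -/
def BivectorField.coeff (w : BivectorField m M) (x₀ : M) (i j : Fin m)
    (y : EuclideanSpace ℝ (Fin m)) : ℝ :=
  localBivector m w.toFun x₀ y ((stdBasis m).coord i) ((stdBasis m).coord j)

/-- The component `[P, Q]ⁱʲᵏ = ∑ₗ ∑_{cyc(i,j,k)} (Pˡᵏ ∂ₗQⁱʲ + Qˡᵏ ∂ₗPⁱʲ)` of the Schouten–Nijenhuis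
bracket of two bivector fields, at the point with coordinates `y` in the chart around `x₀`. -/
def schoutenBracket (P Q : BivectorField m M) (x₀ : M) (y : EuclideanSpace ℝ (Fin m))
    (i j k : Fin m) : ℝ :=
  let D (R S : BivectorField m M) (a b c : Fin m) : ℝ :=
    ∑ l, (R.coeff x₀ l c y * fderiv ℝ (S.coeff x₀ a b) y (stdBasis m l) +
      S.coeff x₀ l c y * fderiv ℝ (R.coeff x₀ a b) y (stdBasis m l))
  D P Q i j k + D P Q j k i + D P Q k i j

/-- `w` is a Poisson bivector field: its Schouten–Nijenhuis bracket `[w, w]` vanishes. -/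
def BivectorField.IsPoisson (w : BivectorField m M) : Prop :=
  ∀ x₀ : M, ∀ y ∈ (extChartAt (𝓡 m) x₀).target, ∀ i j k, schoutenBracket w w x₀ y i j k = 0

theorem coordDeriv_comp_coordFrame {x₀ q : M} (hq : q ∈ (extChartAt (𝓡 m) x₀).source) :
    coordDeriv m x₀ q ∘ₗ coordFrame m x₀ q = LinearMap.id := by
  ext1 v
  exact Bundle.Trivialization.continuousLinearMapAt_symmL _ (by simpa using hq) v

theorem coordFrame_comp_coordDeriv {x₀ q : M} (hq : q ∈ (extChartAt (𝓡 m) x₀).source) :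
    coordFrame m x₀ q ∘ₗ coordDeriv m x₀ q = LinearMap.id := by
  ext1 v
  exact Bundle.Trivialization.symmL_continuousLinearMapAt _ (by simpa using hq) v

theorem coordDeriv_comp_coordFrame' {x₀ x₁ q : M} (h₀ : q ∈ (extChartAt (𝓡 m) x₀).source)
    (h₁ : q ∈ (extChartAt (𝓡 m) x₁).source) :
    coordDeriv m x₁ q ∘ₗ coordFrame m x₀ q =
      (fderiv ℝ (extChartAt (𝓡 m) x₁ ∘ (extChartAt (𝓡 m) x₀).symm) (extChartAt (𝓡 m) x₀ q) :
        EuclideanSpace ℝ (Fin m) →ₗ[ℝ] EuclideanSpace ℝ (Fin m)) := by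
  have h₀' : q ∈ (chartAt (EuclideanSpace ℝ (Fin m)) x₀).source := by simpa using h₀
  have h₁' : q ∈ (chartAt (EuclideanSpace ℝ (Fin m)) x₁).source := by simpa using h₁
  ext1 v
  have h := tangentCoordChange_def (I := 𝓡 m) (x := x₀) (y := x₁) (z := q)
  rw [ModelWithCorners.range_eq_univ, fderivWithin_univ] at h
  have hc := tangentCoordChange_comp (I := 𝓡 m) (w := x₀) (x := q) (y := x₁) (z := q) (v := v)
    ⟨⟨h₀, mem_extChartAt_source q⟩, h₁⟩
  rw [h] at hc
  simp only [coordDeriv, coordFrame]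
  rw [TangentBundle.continuousLinearMapAt_trivializationAt_eq_core h₁',
    TangentBundle.symmL_trivializationAt_eq_core h₀']
  exact hc

theorem localForm_apply (θ : ∀ x : M, ExtAt m x) {x₀ q : M}
    (hq : q ∈ (extChartAt (𝓡 m) x₀).source) :
    localForm m θ x₀ (extChartAt (𝓡 m) x₀ q) = pullExt (coordFrame m x₀ q) (θ q) :=
  congrArg (fun r => pullExt (coordFrame m x₀ r) (θ r)) ((extChartAt (𝓡 m) x₀).left_inv hq)

/-- The exterior derivative of a form, computed at each point in the preferred chart there. -/
def extDerivFun (θ : ∀ x : M, ExtAt m x) (p : M) : ExtAt m p :=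
  pullExt (coordDeriv m p p) (extD (localForm m θ p) (extChartAt (𝓡 m) p p))

/-- In every chart the exterior derivative is given by the coordinate formula. -/
theorem localForm_extDerivFun {θ : ∀ x : M, ExtAt m x} (hθ : θ ∈ smoothForms m M) (x₀ : M)
    {y : EuclideanSpace ℝ (Fin m)} (hy : y ∈ (extChartAt (𝓡 m) x₀).target) :
    localForm m (extDerivFun θ) x₀ y = extD (localForm m θ x₀) y := by
  obtain ⟨q, hq, rfl⟩ : ∃ q ∈ (extChartAt (𝓡 m) x₀).source, extChartAt (𝓡 m) x₀ q = y :=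
    ⟨_, (extChartAt (𝓡 m) x₀).map_target hy, (extChartAt (𝓡 m) x₀).right_inv hy⟩
  set τ : EuclideanSpace ℝ (Fin m) → EuclideanSpace ℝ (Fin m) :=
    extChartAt (𝓡 m) q ∘ (extChartAt (𝓡 m) x₀).symm with hτdef
  have hτq : τ (extChartAt (𝓡 m) x₀ q) = extChartAt (𝓡 m) q q := by
    simp only [hτdef, Function.comp_apply, (extChartAt (𝓡 m) x₀).left_inv hq]
  have hqq : q ∈ (extChartAt (𝓡 m) q).source := mem_extChartAt_source q
  have hmem : extChartAt (𝓡 m) x₀ q ∈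
      ((extChartAt (𝓡 m) x₀).symm ≫ extChartAt (𝓡 m) q).source := by
    rw [PartialEquiv.trans_source'', PartialEquiv.symm_symm, PartialEquiv.symm_target]
    exact Set.mem_image_of_mem _ ⟨hq, hqq⟩
  have hτ : ContDiffAt ℝ ∞ τ (extChartAt (𝓡 m) x₀ q) := by
    have := contDiffWithinAt_ext_coord_change (I := 𝓡 m) (n := ∞) q x₀ hmem
    rwa [ModelWithCorners.range_eq_univ, contDiffWithinAt_univ] at this
  have hev : localForm m θ x₀ =ᶠ[nhds (extChartAt (𝓡 m) x₀ q)]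
      fun z => pullExt (fderiv ℝ τ z : EuclideanSpace ℝ (Fin m) →ₗ[ℝ] EuclideanSpace ℝ (Fin m))
        (localForm m θ q (τ z)) := by
    have h1 : ∀ᶠ z in nhds (extChartAt (𝓡 m) x₀ q), z ∈ (extChartAt (𝓡 m) x₀).target :=
      (isOpen_extChartAt_target x₀).mem_nhds hy
    have h2 : ∀ᶠ z in nhds (extChartAt (𝓡 m) x₀ q),
        (extChartAt (𝓡 m) x₀).symm z ∈ (extChartAt (𝓡 m) q).source :=
      (continuousAt_extChartAt_symm'' hy).eventually_mem
        ((isOpen_extChartAt_source q).mem_nhds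
          (by rwa [(extChartAt (𝓡 m) x₀).left_inv hq]))
    filter_upwards [h1, h2] with z hz1 hz2
    have hr := (extChartAt (𝓡 m) x₀).map_target hz1
    have hz := (extChartAt (𝓡 m) x₀).right_inv hz1
    have e1 : localForm m θ q (τ z) = _ := localForm_apply θ hz2
    have e2 := coordDeriv_comp_coordFrame' hr hz2
    rw [hz, ← hτdef] at e2
    rw [e1, ← e2, ← pullExt_comp, pullExt_comp (coordDeriv m q _),
      coordFrame_comp_coordDeriv hz2, pullExt_id]
    rfl
  have hd : DiffAt (localForm m θ q) (τ (extChartAt (𝓡 m) x₀ q)) := by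
    rw [hτq]
    exact (hθ q).diffAt (isOpen_extChartAt_target q) (mem_extChartAt_target q)
  rw [extD_congr hev, extD_pullExt hτ hd, localForm_apply _ hq, extDerivFun, pullExt_comp,
    coordDeriv_comp_coordFrame' hq hqq, hτq]

theorem extDerivFun_mem {θ : ∀ x : M, ExtAt m x} (hθ : θ ∈ smoothForms m M) :
    extDerivFun θ ∈ smoothForms m M := fun x₀ =>
  ((hθ x₀).extD (isOpen_extChartAt_target x₀)).congr fun _ hy => localForm_extDerivFun hθ x₀ hy

theorem Form.diffAt {θ : ∀ x : M, ExtAt m x} (hθ : θ ∈ smoothForms m M) (p : M) :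
    DiffAt (localForm m θ p) (extChartAt (𝓡 m) p p) :=
  (hθ p).diffAt (isOpen_extChartAt_target p) (mem_extChartAt_target p)

/-- The exterior derivative `d : Ω(M) → Ω(M)`. -/
def extDeriv : Form m M →ₗ[ℝ] Form m M where
  toFun θ := ⟨extDerivFun θ.1, extDerivFun_mem θ.2⟩
  map_add' θ η := by
    refine Subtype.ext (funext fun p => ?_)
    have h : localForm m (θ + η : Form m M).1 p =
        fun z => localForm m θ.1 p z + localForm m η.1 p z :=
      funext fun _ => map_add (pullExt _) _ _
    simp only [extDerivFun, h, extD_add (Form.diffAt θ.2 p) (Form.diffAt η.2 p), map_add]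
    rfl
  map_smul' c θ := by
    refine Subtype.ext (funext fun p => ?_)
    have h : localForm m (c • θ : Form m M).1 p =
        fun z => algebraMap ℝ (Ext ℝ (EuclideanSpace ℝ (Fin m))) c * localForm m θ.1 p z :=
      funext fun _ => (map_smul (pullExt _) _ _).trans (Algebra.smul_def _ _)
    change pullExt (coordDeriv m p p) (extD (localForm m (c • θ : Form m M).1 p) _) =
      c • pullExt (coordDeriv m p p) (extD (localForm m θ.1 p) _)
    rw [h, extD_mul (diffAt_const _) (Form.diffAt θ.2 p), extD_const, zero_mul, zero_add,
      AlgHom.commutes, ← Algebra.smul_def, map_smul]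

variable (w : BivectorField m M)

theorem localForm_quantumTerm (n : ℕ) (α β : ∀ x : M, ExtAt m x) (x₀ : M)
    {y : EuclideanSpace ℝ (Fin m)} (hy : y ∈ (extChartAt (𝓡 m) x₀).target) :
    localForm m (fun x => quantumTerm (tangentBasis m x) (w.toFun x) n (α x) (β x)) x₀ y =
      quantumTerm (stdBasis m) (localBivector m w.toFun x₀ y) n (localForm m α x₀ y)
        (localForm m β x₀ y) :=
  have hq := (extChartAt (𝓡 m) x₀).map_target hy
  quantumTerm_pull _ _ _ _ (coordFrame_comp_coordDeriv hq) (coordDeriv_comp_coordFrame hq) _ _ _ _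

theorem localForm_bivectorContract (α : ∀ x : M, ExtAt m x) (x₀ : M)
    {y : EuclideanSpace ℝ (Fin m)} (hy : y ∈ (extChartAt (𝓡 m) x₀).target) :
    localForm m (fun x => bivectorContract (tangentBasis m x) (w.toFun x) (α x)) x₀ y =
      bivectorContract (stdBasis m) (localBivector m w.toFun x₀ y) (localForm m α x₀ y) :=
  have hq := (extChartAt (𝓡 m) x₀).map_target hy
  bivectorContract_pull _ _ _ _ (coordFrame_comp_coordDeriv hq) (coordDeriv_comp_coordFrame hq) _ _

/-- The contraction `w ⊢ · : Ω(M) → Ω(M)`. -/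
def contract : Form m M →ₗ[ℝ] Form m M where
  toFun α := ⟨fun x => bivectorContract (tangentBasis m x) (w.toFun x) (α.1 x), fun x₀ =>
    ((w.smooth x₀).bivectorContract (α.2 x₀)).congr fun _ hy =>
      localForm_bivectorContract w α.1 x₀ hy⟩
  map_add' _ _ := Subtype.ext <| funext fun _ => map_add _ _ _
  map_smul' _ _ := Subtype.ext <| funext fun _ => map_smul (bivectorContract _ _) _ _

/-- The coefficient of `hⁿ` in the quantum exterior product of two forms, computed fibrewise. -/
def formTerm (n : ℕ) : Form m M →ₗ[ℝ] Form m M →ₗ[ℝ] Form m M :=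
  LinearMap.mk₂ ℝ
    (fun α β => ⟨fun x => quantumTerm (tangentBasis m x) (w.toFun x) n (α.1 x) (β.1 x), fun x₀ =>
      ((w.smooth x₀).quantumTerm (α.2 x₀) (β.2 x₀) n).congr fun _ hy =>
        localForm_quantumTerm w n α.1 β.1 x₀ hy⟩)
    (fun _ _ _ => Subtype.ext <| funext fun _ => LinearMap.map_add₂ _ _ _ _)
    (fun _ _ _ => Subtype.ext <| funext fun _ => LinearMap.map_smul₂ _ _ _ _)
    (fun _ _ _ => Subtype.ext <| funext fun _ => map_add _ _ _)
    (fun _ _ _ => Subtype.ext <| funext fun _ => map_smul (quantumTerm _ _ _ _) _ _)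

/-- Koszul's operator `δα = w ⊢ dα - d(w ⊢ α)`. -/
def koszulDelta : Form m M →ₗ[ℝ] Form m M := contract w ∘ₗ extDeriv - extDeriv ∘ₗ contract w

section Coefficients

/- Here `A` is the ring of coefficients and `h` is the deformation parameter: either `ℝ[h]`, or
`ℝ[h, h⁻¹]`. -/
variable (A : Type*) [CommRing A] [Algebra ℝ A] (h : A)

variable (m M) in
/-- `Ω(M) ⊗ A`, which is `Ω(M)[h]` or `Ω(M)[h, h⁻¹]`. -/
abbrev QuantumForm : Type _ := Form m M ⊗[ℝ] A

/-- The quantum exterior differential `d_h = d - h δ`. -/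
def quantumD : QuantumForm m M A →ₗ[ℝ] QuantumForm m M A :=
  TensorProduct.map (extDeriv : Form m M →ₗ[ℝ] Form m M) (LinearMap.id : A →ₗ[ℝ] A) -
    TensorProduct.map (koszulDelta w) (LinearMap.mulLeft ℝ h)

/-- The quantum exterior product `∧_h`, extended `A`-bilinearly; contractions with more than `m`
vectors vanish, so that only the terms with `n ≤ m` occur. -/
def quantumWedge :
    QuantumForm m M A →ₗ[ℝ] QuantumForm m M A →ₗ[ℝ] QuantumForm m M A :=
  ∑ n ∈ Finset.range (m + 1),
    TensorProduct.map₂ (formTerm w n) ((LinearMap.mul ℝ A).compr₂ (LinearMap.mulLeft ℝ (h ^ n)))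

/-- The cohomology `ker d_h / im d_h`. -/
abbrev QuantumCohomology : Type _ :=
  LinearMap.ker (quantumD w A h) ⧸
    (LinearMap.range (quantumD w A h)).submoduleOf (LinearMap.ker (quantumD w A h))

variable {A h} in
/-- The class of a `d_h`-closed form. -/
def quantumClass (α : QuantumForm m M A) (hα : quantumD w A h α = 0) : QuantumCohomology w A h :=
  Submodule.Quotient.mk ⟨α, hα⟩

variable {A} in
variable (m M) in
/-- The elements of degree `n` of `Ω(M) ⊗ A`. Here `A` has the basis `h ^ e`, the exponents `e`
being indexed by `κ`; a `q`-form times `h ^ e` has degree `q + 2 e`. -/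
def formDegree {κ : Type*} (hpow : κ → A) (e : κ → ℤ) (n : ℤ) :
    Submodule ℝ (QuantumForm m M A) :=
  Submodule.span ℝ {x | ∃ (q : ℕ) (θ : Form m M) (i : κ),
    (∀ p, θ.1 p ∈ ⋀[ℝ]^q (Module.Dual ℝ (TangentSpace (𝓡 m) p))) ∧ (q : ℤ) + 2 * e i = n ∧
      x = θ ⊗ₜ[ℝ] hpow i}

variable {A h} in
/-- The cohomology classes of degree `n`, those of the closed forms of degree `n`. -/
def classDegree {κ : Type*} (hpow : κ → A) (e : κ → ℤ) (n : ℤ) :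
    Submodule ℝ (QuantumCohomology w A h) :=
  ((formDegree m M hpow e n).submoduleOf (LinearMap.ker (quantumD w A h))).map
    (Submodule.mkQ _)

end Coefficients

end Manifold

end QuantumDeRham

end

/-!
Write `L = w ⊢ ·` and let `P` be the pairing `α ⊗ β ↦ ∑ wⁱʲ (α ⊣ eᵢ) ⊗ (eⱼ ⊢ β)`. The proof shows
that the operator `U = exp(-h L)` on `Ω(M) ⊗ A`, a finite sum because `L` is nilpotent, is an
isomorphism from the classical differential graded algebra `(Ω(M) ⊗ A, d, ∧)` onto
`(Ω(M) ⊗ A, d_h, ∧ₕ)`. Everything about the latter is then inherited from the former.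

*The product.* Contraction with a bivector is a second order operator for `∧`: on each fibre
`-L ∘ ∧ = ∧ ∘ (-L ⊗ 1 - 1 ⊗ L + P)` (`bivectorContract_mul`). The three operators on the right
commute, so exponentiating gives `U(α ∧ β) = ∧ ∘ exp(hP) (Uα ⊗ Uβ) = Uα ∧ₕ Uβ`. The coefficients of
the powers of `h` in this identity are compared in `divPow_bivectorContract_mul`, and the result is
`quantumWedge_expContract`.

*The differential.* In a chart the double commutator `[L, [L, d]]` is, up to a factor, the
contraction with `[w, w]`, and so vanishes for a Poisson structure
(`bivectorContract_bivectorContract_extD`, `contract_koszulDelta`). As `δ = [L, d]`, the conjugate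
`exp(-h L) d exp(h L)` has no terms beyond the first order and equals `d - hδ = d_h`
(`quantumD_expContract`).

Hence `d_h² = 0`, `d_h` is a graded derivation of `∧ₕ`, and `∧ₕ` is associative and supercommutative
already on `Ω(M) ⊗ A`. Signs are handled by the parity involution, which commutes with `U`:
supercommutativity is expressed by two bilinear identities, one for the even and one for the odd
part of the first factor (`add_parity_mul`), and an element of degree `n` is an eigenvector of the
involution with eigenvalue `(-1)ⁿ`. The passage to cohomology is `exists_product_of_leibniz`.
-/

noncomputable section

namespace QuantumDeRham

/-! ### Divided powers of commuting operators -/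

section DividedPowers

variable {k R : Type*} [Field k] [Ring R] [Algebra k R]

/-- The divided power `xⁿ / n!`. -/
def divPow (k : Type*) {R : Type*} [Field k] [Ring R] [Algebra k R] (x : R) (n : ℕ) : R :=
  (n.factorial : k)⁻¹ • x ^ n

theorem divPow_zero (x : R) : divPow k x 0 = 1 := by simp [divPow]

theorem divPow_eq_zero {x : R} {n N : ℕ} (hx : x ^ N = 0) (h : N ≤ n) : divPow k x n = 0 := by
  rw [divPow, pow_eq_zero_of_le h hx, smul_zero]

theorem divPow_add [CharZero k] {x y : R} (hxy : Commute x y) (n : ℕ) :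
    divPow k (x + y) n = ∑ p ∈ Finset.HasAntidiagonal.antidiagonal n, divPow k x p.1 * divPow k y p.2 := by
  rw [divPow, hxy.add_pow', Finset.smul_sum]
  refine Finset.sum_congr rfl fun p hp => ?_
  rw [divPow, divPow, smul_mul_smul_comm, ← Nat.cast_smul_eq_nsmul k, smul_smul]
  congr 1
  obtain rfl := Finset.HasAntidiagonal.mem_antidiagonal.mp hp
  have h := Nat.add_choose_mul_factorial_mul_factorial p.1 p.2
  have h1 := Nat.cast_ne_zero (R := k).mpr (Nat.factorial_ne_zero (p.1 + p.2))
  have h2 := Nat.cast_ne_zero (R := k).mpr (Nat.factorial_ne_zero p.1)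
  have h3 := Nat.cast_ne_zero (R := k).mpr (Nat.factorial_ne_zero p.2)
  field_simp
  rw [← Nat.choose_symm_add] at h
  exact_mod_cast h

/-- For a finitely supported family, summing over total degree is the same as summing over a box that contains the support. -/
theorem sum_range_antidiagonal {W : Type*} [AddCommMonoid W] (g : ℕ × ℕ → W) {K₁ K₂ K : ℕ}
    (hK : K₁ + K₂ ≤ K) (h₁ : ∀ p, K₁ ≤ p.1 → g p = 0) (h₂ : ∀ p, K₂ ≤ p.2 → g p = 0) :
    ∑ n ∈ Finset.range K, ∑ p ∈ Finset.HasAntidiagonal.antidiagonal n, g p =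
      ∑ i ∈ Finset.range K₁, ∑ j ∈ Finset.range K₂, g (i, j) := by
  rw [← Finset.sum_product', ← Finset.sum_fiberwise_of_maps_to (g := fun p : ℕ × ℕ => p.1 + p.2)
    (t := Finset.range K)]
  · refine Finset.sum_congr rfl fun n _ => ?_
    symm
    refine Finset.sum_subset (fun p hp => ?_) fun p hp hp' => ?_
    · simpa using (Finset.mem_filter.mp hp).2
    · by_contra hne
      refine hp' (Finset.mem_filter.mpr ⟨Finset.mem_product.mpr ⟨?_, ?_⟩, by simpa using hp⟩)
      · exact Finset.mem_range.mpr (not_le.mp fun h => hne (h₁ p h))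
      · exact Finset.mem_range.mpr (not_le.mp fun h => hne (h₂ p h))
  · intro p hp
    have := Finset.mem_product.mp hp
    simp only [Finset.mem_range] at this ⊢
    omega

end DividedPowers

/-! ### Contractions and the exterior product on a vector space -/

section Fibre

variable {k V : Type*} [Field k] [AddCommGroup V] [Module k V]

/-- The parity involution of `Λ(V*)`, equal to `(-1)^q` on forms of degree `q`. -/
def parity : Ext k V →ₐ[k] Ext k V := CliffordAlgebra.involute

theorem parity_ι (ξ : Module.Dual k V) :
    parity (ExteriorAlgebra.ι k ξ) = -ExteriorAlgebra.ι k ξ :=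
  CliffordAlgebra.involute_ι _

theorem parity_parity (a : Ext k V) : parity (parity a) = a :=
  CliffordAlgebra.involute_involute a

/-- To prove a linear statement on `Λ(V*)` it is enough to treat scalars and to pass from `a`
to `ξ ∧ a`. -/
theorem ext_induction {p : Ext k V → Prop} (a : Ext k V)
    (scalar : ∀ r : k, p (algebraMap k _ r)) (add : ∀ a b, p a → p b → p (a + b))
    (ι_mul : ∀ ξ a, p a → p (ExteriorAlgebra.ι k ξ * a)) : p a := by
  induction a using CliffordAlgebra.left_induction with
  | algebraMap r => exact scalar r
  | add a b ha hb => exact add a b ha hb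
  | ι_mul a ξ h => exact ι_mul ξ a h

theorem leftContract_ι_mul (v : V) (ξ : Module.Dual k V) (a : Ext k V) :
    leftContract v (ExteriorAlgebra.ι k ξ * a) =
      ξ v • a - ExteriorAlgebra.ι k ξ * leftContract v a :=
  CliffordAlgebra.contractLeft_ι_mul _ _ _

theorem leftContract_algebraMap (v : V) (r : k) :
    leftContract v (algebraMap k (Ext k V) r) = 0 :=
  CliffordAlgebra.contractLeft_algebraMap _ _ r

theorem leftContract_leftContract_self (v : V) (a : Ext k V) :
    leftContract v (leftContract v a) = 0 :=
  CliffordAlgebra.contractLeft_contractLeft _ a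

theorem leftContract_leftContract (u v : V) (a : Ext k V) :
    leftContract u (leftContract v a) = -leftContract v (leftContract u a) :=
  CliffordAlgebra.contractLeft_comm _ _ a

theorem leftContract_parity (v : V) (a : Ext k V) :
    leftContract v (parity a) = -parity (leftContract v a) := by
  induction a using ext_induction with
  | scalar r => rw [AlgHom.commutes, leftContract_algebraMap, map_zero, neg_zero]
  | add a b ha hb => simp only [map_add, ha, hb, neg_add]
  | ι_mul ξ a h =>
    rw [map_mul, parity_ι, neg_mul, map_neg, leftContract_ι_mul, leftContract_ι_mul, h, map_sub,
      map_smul, map_mul, parity_ι]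
    simp

theorem leftContract_mul (v : V) (a b : Ext k V) :
    leftContract v (a * b) = leftContract v a * b + parity a * leftContract v b := by
  induction a using ext_induction with
  | scalar r =>
    rw [AlgHom.commutes, leftContract_algebraMap, ← Algebra.smul_def, ← Algebra.smul_def, map_smul,
      zero_mul, zero_add]
  | add a c ha hc => simp only [map_add, add_mul, ha, hc]; abel
  | ι_mul ξ a h =>
    rw [mul_assoc, leftContract_ι_mul, leftContract_ι_mul, h, map_mul, parity_ι]
    simp only [sub_mul, mul_add, smul_mul_assoc, neg_mul, mul_assoc]
    abel

theorem ι_mul_parity (ξ : Module.Dual k V) (a : Ext k V) :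
    ExteriorAlgebra.ι k ξ * parity a = a * ExteriorAlgebra.ι k ξ := by
  induction a using ext_induction with
  | scalar r => rw [AlgHom.commutes, Algebra.commutes]
  | add a b ha hb => simp only [map_add, mul_add, add_mul, ha, hb]
  | ι_mul η a h =>
    have h' := eq_neg_of_add_eq_zero_left (ExteriorAlgebra.ι_add_mul_swap (R := k) ξ η)
    rw [map_mul, parity_ι, neg_mul, mul_neg, ← mul_assoc, h', neg_mul, neg_neg, mul_assoc, h,
      mul_assoc]

theorem ι_mul_eq_parity_mul (ξ : Module.Dual k V) (a : Ext k V) :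
    ExteriorAlgebra.ι k ξ * a = parity a * ExteriorAlgebra.ι k ξ := by
  rw [← ι_mul_parity, parity_parity]

/-- Insertion in the last slot of a `q`-form differs from insertion in the first slot by
`(-1)^(q-1)`. -/
theorem rightContract_eq (v : V) (a : Ext k V) : rightContract v a = parity (leftContract v a) := by
  induction a using CliffordAlgebra.right_induction with
  | algebraMap r =>
    have h : leftContract v (algebraMap k (Ext k V) r) = 0 := leftContract_algebraMap v r
    erw [h, map_zero]
    exact CliffordAlgebra.contractRight_algebraMap _ _ r
  | add a b ha hb => simp only [map_add, ha, hb]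
  | mul_ι ξ a h =>
    have h1 : rightContract v (a * ExteriorAlgebra.ι k ξ) =
        ξ v • a - rightContract v a * ExteriorAlgebra.ι k ξ :=
      CliffordAlgebra.contractRight_mul_ι _ _ _
    have h2 : leftContract v (ExteriorAlgebra.ι k ξ) = algebraMap k (Ext k V) (ξ v) :=
      CliffordAlgebra.contractLeft_ι _ _ ξ
    refine h1.trans ?_
    change _ = parity (leftContract v (a * ExteriorAlgebra.ι k ξ))
    rw [leftContract_mul, h2, h, map_add, map_mul, map_mul, parity_ι, parity_parity,
      AlgHom.commutes, ← Algebra.commutes, ← Algebra.smul_def, mul_neg]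
    abel

/-- Supercommutativity of `∧`, in a form bilinear in `a` and `b`: twice the even part of `a` commutes
with every `b`, and twice the odd part of `a` commutes with `b` up to the parity of `b`. -/
theorem add_parity_mul (a b : Ext k V) :
    a * b + parity a * b = b * a + b * parity a ∧
      a * b - parity a * b = parity b * a - parity b * parity a := by
  induction a using ext_induction generalizing b with
  | scalar r =>
    simp only [AlgHom.commutes, sub_self, and_true, ← two_mul, Algebra.commutes]
  | add a c ha hc =>
    obtain ⟨h1, h2⟩ := ha b
    obtain ⟨h3, h4⟩ := hc b
    simp only [map_add, add_mul, mul_add]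
    constructor
    · rw [add_add_add_comm, h1, h3]; abel
    · rw [add_sub_add_comm, h2, h4]; abel
  | ι_mul ξ a h =>
    obtain ⟨h1, h2⟩ := h b
    have e1 := congrArg (ExteriorAlgebra.ι k ξ * ·) h1
    have e2 := congrArg (ExteriorAlgebra.ι k ξ * ·) h2
    simp only [mul_add, mul_sub, ← mul_assoc, ι_mul_parity ξ b, ι_mul_eq_parity_mul ξ b] at e1 e2
    simp only [map_mul, parity_ι, neg_mul, mul_neg, ← mul_assoc, ← sub_eq_add_neg, sub_neg_eq_add]
    exact ⟨e2, e1⟩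

variable {ι : Type*} [Fintype ι] (e : Module.Basis ι k V)
  (w : LinearMap.BilinForm k (Module.Dual k V))

theorem bivectorContract_apply (a : Ext k V) : bivectorContract e w a =
    (2 : k)⁻¹ • ∑ i, ∑ j, w (e.coord i) (e.coord j) • leftContract (e i) (leftContract (e j) a) := by
  simp only [bivectorContract, LinearMap.smul_apply, LinearMap.sum_apply, LinearMap.comp_apply]

theorem pairContract_tmul (a b : Ext k V) : pairContract e w (a ⊗ₜ b) =
    ∑ i, ∑ j, w (e.coord i) (e.coord j) • rightContract (e i) a ⊗ₜ leftContract (e j) b := by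
  simp only [pairContract, LinearMap.smul_apply, LinearMap.sum_apply, TensorProduct.map_tmul]

theorem bivectorContract_parity (a : Ext k V) :
    bivectorContract e w (parity a) = parity (bivectorContract e w a) := by
  simp only [bivectorContract_apply, leftContract_parity, map_neg, map_smul, map_sum, neg_neg]

theorem bivectorContract_leftContract (v : V) (a : Ext k V) :
    bivectorContract e w (leftContract v a) = leftContract v (bivectorContract e w a) := by
  simp only [bivectorContract_apply, map_smul, map_sum]
  refine congrArg _ (Finset.sum_congr rfl fun i _ => Finset.sum_congr rfl fun j _ => ?_)
  rw [leftContract_leftContract (e j) v, map_neg, leftContract_leftContract (e i) v, neg_neg]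

theorem bivectorContract_rightContract (v : V) (a : Ext k V) :
    bivectorContract e w (rightContract v a) = rightContract v (bivectorContract e w a) := by
  rw [rightContract_eq, rightContract_eq, bivectorContract_parity, bivectorContract_leftContract]

/-- Contraction with a bivector is a second order operator for the exterior product, and its
failure to be a derivation is the pairing that defines the quantum exterior product. -/
theorem bivectorContract_mul [CharZero k] (hw : w.IsAlt) (a b : Ext k V) :
    bivectorContract e w (a * b) = bivectorContract e w a * b + a * bivectorContract e w b -
      LinearMap.mul' k _ (pairContract e w (a ⊗ₜ b)) := by
  have h : ∀ i j, leftContract (e i) (leftContract (e j) (a * b)) =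
      leftContract (e i) (leftContract (e j) a) * b + a * leftContract (e i) (leftContract (e j) b)
      + rightContract (e j) a * leftContract (e i) b
      - rightContract (e i) a * leftContract (e j) b := by
    intro i j
    rw [leftContract_mul, map_add, leftContract_mul, leftContract_mul, leftContract_parity,
      rightContract_eq, rightContract_eq, parity_parity]
    simp only [neg_mul]
    abel
  have hs : ∑ i, ∑ j, w (e.coord i) (e.coord j) • (rightContract (e j) a * leftContract (e i) b) =
      -∑ i, ∑ j, w (e.coord i) (e.coord j) • (rightContract (e i) a * leftContract (e j) b) := by
    rw [Finset.sum_comm, ← Finset.sum_neg_distrib]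
    refine Finset.sum_congr rfl fun i _ => ?_
    rw [← Finset.sum_neg_distrib]
    refine Finset.sum_congr rfl fun j _ => ?_
    rw [← LinearMap.BilinForm.IsAlt.neg_eq hw, neg_smul]
  simp only [bivectorContract_apply, pairContract_tmul, h, map_sum, map_smul, LinearMap.mul'_apply,
    smul_add, smul_sub, Finset.sum_add_distrib, Finset.sum_sub_distrib, hs, smul_mul_assoc,
    mul_smul_comm, Finset.sum_mul, Finset.mul_sum, smul_neg]
  rw [← sub_eq_add_neg, sub_sub, ← two_smul k, smul_smul, mul_inv_cancel₀ two_ne_zero, one_smul]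

theorem quantumTerm_eq_divPow (n : ℕ) (a b : Ext k V) :
    quantumTerm e w n a b = LinearMap.mul' k _ (divPow k (pairContract e w) n (a ⊗ₜ b)) := by
  simp [quantumTerm, divPow]

theorem quantumTerm_zero (a b : Ext k V) : quantumTerm e w 0 a b = a * b := by
  simp [quantumTerm]

/-- The coefficient of `hᴺ` in `exp(-h w⊢)(a ∧ b) = (exp(-h w⊢) a) ∧ₕ (exp(-h w⊢) b)`. -/
theorem divPow_bivectorContract_mul [CharZero k] (hw : w.IsAlt) (N : ℕ) (a b : Ext k V) :
    divPow k (-bivectorContract e w) N (a * b) =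
      ∑ p ∈ Finset.HasAntidiagonal.antidiagonal N, ∑ q ∈ Finset.HasAntidiagonal.antidiagonal p.2,
        quantumTerm e w p.1 (divPow k (-bivectorContract e w) q.1 a)
          (divPow k (-bivectorContract e w) q.2 b) := by
  set L := bivectorContract e w
  set P := pairContract e w
  let A : Module.End k (Ext k V ⊗[k] Ext k V) := TensorProduct.map (-L) LinearMap.id
  let B : Module.End k (Ext k V ⊗[k] Ext k V) := TensorProduct.map LinearMap.id (-L)
  have hA : ∀ n c d, divPow k A n (c ⊗ₜ d) = divPow k (-L) n c ⊗ₜ d := by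
    intro n c d
    have : (A ^ n) (c ⊗ₜ d) = ((-L) ^ n) c ⊗ₜ d := by
      rw [TensorProduct.map_pow]; simp [← Module.End.one_eq_id]
    simp [divPow, this, TensorProduct.smul_tmul']
  have hB : ∀ n c d, divPow k B n (c ⊗ₜ d) = c ⊗ₜ divPow k (-L) n d := by
    intro n c d
    have : (B ^ n) (c ⊗ₜ d) = c ⊗ₜ ((-L) ^ n) d := by
      rw [TensorProduct.map_pow]; simp [← Module.End.one_eq_id]
    simp [divPow, this]
  have hAB : Commute A B := by
    refine TensorProduct.ext' fun c d => ?_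
    simp [A, B]
  have hPA : Commute P A := by
    refine TensorProduct.ext' fun c d => ?_
    simp only [A, P, L, Module.End.mul_apply, TensorProduct.map_tmul, pairContract_tmul, map_sum,
      map_smul, LinearMap.neg_apply, map_neg, bivectorContract_rightContract, LinearMap.id_apply]
  have hPB : Commute P B := by
    refine TensorProduct.ext' fun c d => ?_
    simp only [B, P, L, Module.End.mul_apply, TensorProduct.map_tmul, pairContract_tmul, map_sum,
      map_smul, LinearMap.neg_apply, map_neg, bivectorContract_leftContract, LinearMap.id_apply]
  have hm : ∀ c, -L (LinearMap.mul' k _ c) = LinearMap.mul' k _ ((P + (A + B)) c) := by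
    intro c
    induction c using TensorProduct.induction_on with
    | zero => simp
    | add x y hx hy => simp only [map_add, neg_add, hx, hy]
    | tmul x y =>
      simp only [LinearMap.mul'_apply, L, bivectorContract_mul e w hw, LinearMap.add_apply, A, B,
        TensorProduct.map_tmul, map_add, LinearMap.neg_apply, LinearMap.id_apply, P, neg_mul,
        mul_neg]
      abel
  have hpow : ∀ n c, ((-L) ^ n) (LinearMap.mul' k _ c) =
      LinearMap.mul' k _ (((P + (A + B)) ^ n) c) := by
    intro n
    induction n with
    | zero => simp
    | succ n ih =>
      intro c
      rw [pow_succ', pow_succ', Module.End.mul_apply, Module.End.mul_apply, ih, ← hm]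
      rfl
  have h : divPow k (-L) N (a * b) =
      LinearMap.mul' k _ (divPow k (P + (A + B)) N (a ⊗ₜ b)) := by
    simp only [divPow, LinearMap.smul_apply, map_smul, ← hpow, LinearMap.mul'_apply]
  rw [h, divPow_add (hPA.add_right hPB), LinearMap.sum_apply, map_sum]
  refine Finset.sum_congr rfl fun p _ => ?_
  rw [divPow_add hAB, Module.End.mul_apply, LinearMap.sum_apply, map_sum, map_sum]
  refine Finset.sum_congr rfl fun q _ => ?_
  rw [Module.End.mul_apply, hB, hA, quantumTerm_eq_divPow]

/-! ### Nilpotency of contractions -/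

variable (k V) in
/-- The contraction of forms with multivectors: the extension of `v ↦ v ⊢ ·` to an algebra
homomorphism on `Λ(V)`. -/
def multiContract : ExteriorAlgebra k V →ₐ[k] Module.End k (Ext k V) :=
  ExteriorAlgebra.lift k ⟨CliffordAlgebra.contractLeft ∘ₗ Module.Dual.eval k V, fun v =>
    LinearMap.ext fun a => leftContract_leftContract_self v a⟩

theorem multiContract_ι (v : V) : multiContract k V (ExteriorAlgebra.ι k v) = leftContract v :=
  ExteriorAlgebra.lift_ι_apply _ _ _ _

theorem exteriorPower_eq_bot [Module.Finite k V] {n : ℕ} (hn : Module.finrank k V < n) :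
    ⋀[k]^n V = ⊥ := by
  rw [← Submodule.finrank_eq_zero (R := k), exteriorPower.finrank_eq, Nat.choose_eq_zero_of_lt hn]

theorem ι_mem_exteriorPower (v : V) : ExteriorAlgebra.ι k v ∈ ⋀[k]^1 V := by
  rw [ExteriorAlgebra.exteriorPower, pow_one]
  exact LinearMap.mem_range_self _ v

theorem neg_bivectorContract_pow_eq_zero [Module.Finite k V] {n : ℕ}
    (hn : Module.finrank k V < n) : (-bivectorContract e w) ^ n = 0 := by
  let x : ExteriorAlgebra k V := (2 : k)⁻¹ • ∑ i, ∑ j, w (e.coord i) (e.coord j) •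
    (ExteriorAlgebra.ι k (e i) * ExteriorAlgebra.ι k (e j))
  have hx : bivectorContract e w = multiContract k V x := by
    simp only [x, map_smul, map_sum, map_mul, multiContract_ι, bivectorContract,
      Module.End.mul_eq_comp]
  have hx2 : x ∈ ⋀[k]^2 V := by
    refine Submodule.smul_mem _ _ (Submodule.sum_mem _ fun i _ => Submodule.sum_mem _ fun j _ =>
      Submodule.smul_mem _ _ ?_)
    rw [ExteriorAlgebra.exteriorPower, pow_two]
    exact Submodule.mul_mem_mul (LinearMap.mem_range_self _ _) (LinearMap.mem_range_self _ _)
  have hxn : x ^ n ∈ ⋀[k]^(2 * n) V := by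
    rw [ExteriorAlgebra.exteriorPower, pow_mul]
    exact Submodule.pow_mem_pow _ hx2 n
  rw [exteriorPower_eq_bot (by omega), Submodule.mem_bot] at hxn
  rw [hx, ← map_neg, ← map_pow, neg_pow, hxn, mul_zero, map_zero]

variable (k V) in
/-- The operators `∑ f ⊗ (x ⊢ ·)` on `Λ(V*) ⊗ Λ(V*)`, where the `x` are multivectors of degree
`n`. -/
def secondSlotContractions (n : ℕ) : Submodule k (Module.End k (Ext k V ⊗[k] Ext k V)) :=
  Submodule.span k {T | ∃ (f : Module.End k (Ext k V)) (x : ExteriorAlgebra k V),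
    x ∈ ⋀[k]^n V ∧ T = TensorProduct.map f (multiContract k V x)}

theorem mul_mem_secondSlotContractions {n p : ℕ} {S T : Module.End k (Ext k V ⊗[k] Ext k V)}
    (hS : S ∈ secondSlotContractions k V n) (hT : T ∈ secondSlotContractions k V p) :
    S * T ∈ secondSlotContractions k V (n + p) := by
  have h := Submodule.mul_mem_mul hS hT
  rw [secondSlotContractions, secondSlotContractions, Submodule.span_mul_span] at h
  refine Submodule.span_mono ?_ h
  rintro _ ⟨_, ⟨f, x, hx, rfl⟩, _, ⟨g, y, hy, rfl⟩, rfl⟩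
  refine ⟨f * g, x * y, ?_, ?_⟩
  · rw [ExteriorAlgebra.exteriorPower, pow_add]
    exact Submodule.mul_mem_mul hx hy
  · rw [map_mul]
    exact (TensorProduct.map_mul _ _ _ _).symm

theorem pairContract_pow_mem (n : ℕ) :
    pairContract e w ^ n ∈ secondSlotContractions k V n := by
  induction n with
  | zero =>
    refine Submodule.subset_span ⟨1, 1, ?_, ?_⟩
    · rw [ExteriorAlgebra.exteriorPower, pow_zero]
      exact Submodule.one_le.mp le_rfl
    · rw [map_one, pow_zero]
      exact TensorProduct.map_one.symm
  | succ n ih =>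
    rw [pow_succ]
    refine mul_mem_secondSlotContractions ih ?_
    refine Submodule.sum_mem _ fun i _ => Submodule.sum_mem _ fun j _ =>
      Submodule.smul_mem _ _ (Submodule.subset_span
        ⟨rightContract (e i), _, ι_mem_exteriorPower (e j), ?_⟩)
    rw [multiContract_ι]

/-- The `n`-th term inserts an `n`-vector into the second factor, and there are none for
`n > dim V`. -/
theorem quantumTerm_eq_zero [Module.Finite k V] {n : ℕ} (hn : Module.finrank k V < n) :
    quantumTerm e w n = 0 := by
  have h : pairContract e w ^ n = 0 := by
    have h := pairContract_pow_mem e w n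
    rw [secondSlotContractions, exteriorPower_eq_bot hn] at h
    rw [← Submodule.mem_bot (R := k)]
    refine Submodule.span_le.mpr ?_ h
    rintro _ ⟨f, x, hx, rfl⟩
    rw [Submodule.mem_bot] at hx
    subst hx
    rw [map_zero]
    exact TensorProduct.map_zero_right f
  rw [quantumTerm, h, LinearMap.comp_zero]
  ext; simp

theorem parity_eq_of_mem {q : ℕ} {a : Ext k V} (ha : a ∈ ⋀[k]^q (Module.Dual k V)) :
    parity a = (-1 : k) ^ q • a := by
  induction ha using Submodule.pow_induction_on_left' with
  | algebraMap r => simp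
  | add x y i hx hy h1 h2 => rw [map_add, h1, h2, smul_add]
  | mem_mul ξ hξ i x hx h =>
    obtain ⟨ξ, rfl⟩ := hξ
    rw [map_mul, parity_ι, h, pow_succ, mul_smul_comm, neg_mul, smul_neg]
    simp

end Fibre

/-! ### Differential forms on Euclidean space -/

section Coordinates

variable {m : ℕ} {F G : EuclideanSpace ℝ (Fin m) → Ext ℝ (EuclideanSpace ℝ (Fin m))}
  {U : Set (EuclideanSpace ℝ (Fin m))} {y : EuclideanSpace ℝ (Fin m)}

theorem DiffAt.linear (hF : DiffAt F y) (T : Module.End ℝ (Ext ℝ (EuclideanSpace ℝ (Fin m)))) :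
    DiffAt (fun z => T (F z)) y := by
  intro I
  have h : (fun z => (formBasis m).coord I (T (F z))) = fun z => ∑ J,
      (formBasis m).coord J (F z) * (formBasis m).coord I (T (formBasis m J)) := by
    funext z
    conv_lhs => rw [← (formBasis m).sum_repr (F z)]
    simp only [map_sum, map_smul, smul_eq_mul, Module.Basis.coord_apply]
  rw [h]
  exact DifferentiableAt.fun_sum fun J _ => (hF J).mul_const _

theorem partialD_sum {κ : Type*} (s : Finset κ)
    {H : κ → EuclideanSpace ℝ (Fin m) → Ext ℝ (EuclideanSpace ℝ (Fin m))}
    (hH : ∀ j ∈ s, DiffAt (H j) y) (i : Fin m) :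
    partialD i (fun z => ∑ j ∈ s, H j z) y = ∑ j ∈ s, partialD i (H j) y := by
  classical
  induction s using Finset.induction_on with
  | empty => simpa using partialD_const (y := y) i 0
  | insert a s ha ih =>
    simp only [Finset.sum_insert ha]
    rw [partialD_add (hH a (Finset.mem_insert_self _ _))
      (DiffAt.sum s fun j hj => hH j (Finset.mem_insert_of_mem hj)),
      ih fun j hj => hH j (Finset.mem_insert_of_mem hj)]

theorem partialD_linear (hF : DiffAt F y)
    (T : Module.End ℝ (Ext ℝ (EuclideanSpace ℝ (Fin m)))) (i : Fin m) :
    partialD i (fun z => T (F z)) y = T (partialD i F y) := by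
  have h : (fun z => T (F z)) = fun z => ∑ J, (formBasis m).coord J (F z) • T (formBasis m J) := by
    funext z
    conv_lhs => rw [← (formBasis m).sum_repr (F z)]
    simp only [map_sum, map_smul, Module.Basis.coord_apply]
  rw [h, partialD_sum _ fun J _ => DiffAt.smul_const (hF J) _]
  simp only [partialD_smul_const (hF _)]
  rw [partialD.eq_1 i F y, map_sum]
  simp only [map_smul]

theorem DiffAt.smul {f : EuclideanSpace ℝ (Fin m) → ℝ} (hf : DifferentiableAt ℝ f y)
    (hF : DiffAt F y) : DiffAt (fun z => f z • F z) y := fun I => by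
  simpa only [map_smul, smul_eq_mul] using hf.fun_mul (hF I)

theorem partialD_smul {f : EuclideanSpace ℝ (Fin m) → ℝ} (hf : DifferentiableAt ℝ f y)
    (hF : DiffAt F y) (i : Fin m) : partialD i (fun z => f z • F z) y =
      fderiv ℝ f y (stdBasis m i) • F y + f y • partialD i F y := by
  have h := partialD_mul (DiffAt.smul_const hf 1) hF i
  rw [partialD_smul_const hf] at h
  simpa only [smul_mul_assoc, one_mul] using h

theorem SmoothOn.partialD (hU : IsOpen U) (hF : SmoothOn F U) (i : Fin m) :
    SmoothOn (QuantumDeRham.partialD i F) U := by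
  refine SmoothOn.sum _ fun I _ => SmoothOn.smul ?_ (SmoothOn.const _ _)
  exact ((hF _).fderiv_of_isOpen hU (by simp)).clm_apply contDiffOn_const

theorem partialD_comm (hU : IsOpen U) (hF : SmoothOn F U) (hy : y ∈ U) (i j : Fin m) :
    partialD i (partialD j F) y = partialD j (partialD i F) y := by
  apply (formBasis m).ext_elem
  intro I
  rw [← Module.Basis.coord_apply, ← Module.Basis.coord_apply, coord_partialD, coord_partialD]
  simp only [coord_partialD]
  have hc : ContDiffAt ℝ ∞ (fun z => (formBasis m).coord I (F z)) y :=
    (hF _).contDiffAt (hU.mem_nhds hy)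
  have hd : DifferentiableAt ℝ (fderiv ℝ fun z => (formBasis m).coord I (F z)) y :=
    (hc.fderiv_right (m := 1) (by norm_cast)).differentiableAt (by norm_num)
  have h : ∀ v, fderiv ℝ (fun z => fderiv ℝ (fun z => (formBasis m).coord I (F z)) z v) y =
      (fderiv ℝ (fderiv ℝ fun z => (formBasis m).coord I (F z)) y).flip v := fun v => by
    simpa using (hd.hasFDerivAt.clm_apply (hasFDerivAt_const v y)).fderiv
  have hs : IsSymmSndFDerivAt ℝ (fun z => (formBasis m).coord I (F z)) y :=
    hc.isSymmSndFDerivAt (by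
      rw [minSmoothness_of_isRCLikeNormedField]
      exact WithTop.coe_le_coe.mpr le_top)
  rw [h, h]
  exact hs.eq _ _

theorem partialD_extD (hU : IsOpen U) (hF : SmoothOn F U) (hy : y ∈ U) (i : Fin m) :
    partialD i (extD F) y = ∑ j, dx j * partialD i (partialD j F) y := by
  have hd : ∀ j, DiffAt (partialD j F) y := fun j => (hF.partialD hU j).diffAt hU hy
  have h := partialD_sum (y := y) Finset.univ (H := fun j z => dx j * partialD j F z)
    (fun j _ => (hd j).linear (LinearMap.mulLeft ℝ (dx j))) i
  refine h.trans (Finset.sum_congr rfl fun j _ => ?_)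
  exact partialD_linear (hd j) (LinearMap.mulLeft ℝ (dx j)) i

theorem extD_extD (hU : IsOpen U) (hF : SmoothOn F U) (hy : y ∈ U) : extD (extD F) y = 0 := by
  have h : extD (extD F) y = ∑ i, ∑ j, dx i * (dx j * partialD i (partialD j F) y) := by
    simp only [extD, ← Finset.mul_sum]
    exact Finset.sum_congr rfl fun i _ => congrArg _ (partialD_extD hU hF hy i)
  have h' : extD (extD F) y = -extD (extD F) y := by
    conv_lhs => rw [h, Finset.sum_comm]
    rw [h, ← Finset.sum_neg_distrib]
    refine Finset.sum_congr rfl fun i _ => ?_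
    rw [← Finset.sum_neg_distrib]
    refine Finset.sum_congr rfl fun j _ => ?_
    have hs := eq_neg_of_add_eq_zero_left (ExteriorAlgebra.ι_add_mul_swap (R := ℝ)
      ((stdBasis m).coord j) ((stdBasis m).coord i))
    rw [partialD_comm hU hF hy, ← mul_assoc, ← mul_assoc, dx, dx, hs, neg_mul]
  have h2 := add_eq_zero_iff_eq_neg.mpr h'
  rw [← two_smul ℝ] at h2
  exact (smul_eq_zero.mp h2).resolve_left two_ne_zero

/-! ### The Poisson condition in coordinates -/

section Poisson

variable {P : EuclideanSpace ℝ (Fin m) →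
    LinearMap.BilinForm ℝ (Module.Dual ℝ (EuclideanSpace ℝ (Fin m)))}

/-- The contraction with the bivector whose coefficients are the derivatives `∂ₗwⁱʲ`. -/
def derivContract (P : EuclideanSpace ℝ (Fin m) →
      LinearMap.BilinForm ℝ (Module.Dual ℝ (EuclideanSpace ℝ (Fin m))))
    (y : EuclideanSpace ℝ (Fin m)) (l : Fin m) : Module.End ℝ (Ext ℝ (EuclideanSpace ℝ (Fin m))) :=
  (2 : ℝ)⁻¹ • ∑ i, ∑ j, fderiv ℝ (fun z => P z ((stdBasis m).coord i) ((stdBasis m).coord j)) y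
    (stdBasis m l) • leftContract (stdBasis m i) ∘ₗ leftContract (stdBasis m j)

/-- The contraction with the vector `w(·, dxˡ) = ∑ᵢ wⁱˡ eᵢ`. -/
def hamContract (w : LinearMap.BilinForm ℝ (Module.Dual ℝ (EuclideanSpace ℝ (Fin m))))
    (l : Fin m) : Module.End ℝ (Ext ℝ (EuclideanSpace ℝ (Fin m))) :=
  ∑ i, w ((stdBasis m).coord i) ((stdBasis m).coord l) • leftContract (stdBasis m i)

theorem bivectorContract_dx_mul
    {w : LinearMap.BilinForm ℝ (Module.Dual ℝ (EuclideanSpace ℝ (Fin m)))} (hw : w.IsAlt)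
    (l : Fin m) (a : Ext ℝ (EuclideanSpace ℝ (Fin m))) :
    bivectorContract (stdBasis m) w (dx l * a) =
      dx l * bivectorContract (stdBasis m) w a + hamContract w l a := by
  have hp : LinearMap.mul' ℝ _ (pairContract (stdBasis m) w (dx l ⊗ₜ a)) = -hamContract w l a := by
    have hr : ∀ i, rightContract (stdBasis m i) (dx l) =
        algebraMap ℝ (Ext ℝ (EuclideanSpace ℝ (Fin m))) (if l = i then 1 else 0) := by
      intro i
      have h : leftContract (stdBasis m i) (dx l) =
          algebraMap ℝ (Ext ℝ (EuclideanSpace ℝ (Fin m))) ((stdBasis m).coord l (stdBasis m i)) :=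
        CliffordAlgebra.contractLeft_ι _ _ _
      rw [rightContract_eq, h, AlgHom.commutes, Module.Basis.coord_apply, Module.Basis.repr_self,
        Finsupp.single_apply]
      simp only [eq_comm]
    simp only [pairContract_tmul, hr, map_sum, map_smul, LinearMap.mul'_apply,
      ← Algebra.smul_def, hamContract, LinearMap.sum_apply, LinearMap.smul_apply]
    rw [Finset.sum_comm, ← Finset.sum_neg_distrib]
    refine Finset.sum_congr rfl fun j _ => ?_
    simp only [ite_smul, one_smul, zero_smul, smul_ite, smul_zero, Finset.sum_ite_eq,
      Finset.mem_univ, if_true]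
    rw [← LinearMap.BilinForm.IsAlt.neg_eq hw, neg_smul]
  have h0 : bivectorContract (stdBasis m) w (dx l) = 0 := by
    have h : ∀ i, leftContract (stdBasis m i) (dx l) =
          algebraMap ℝ (Ext ℝ (EuclideanSpace ℝ (Fin m))) ((stdBasis m).coord l (stdBasis m i)) :=
      fun i => CliffordAlgebra.contractLeft_ι _ _ _
    simp [bivectorContract_apply, h, leftContract_algebraMap]
  rw [bivectorContract_mul _ _ hw, hp, h0, zero_mul, zero_add, sub_neg_eq_add]

theorem DiffAt.bivectorContract
    (hP : ∀ i j, DifferentiableAt ℝ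
      (fun z => P z ((stdBasis m).coord i) ((stdBasis m).coord j)) y)
    (hF : DiffAt F y) : DiffAt (fun z => bivectorContract (stdBasis m) (P z) (F z)) y := by
  simp only [bivectorContract_apply]
  exact DiffAt.smul (differentiableAt_const _) (DiffAt.sum _ fun i _ => DiffAt.sum _ fun j _ =>
    DiffAt.smul (hP i j) ((hF.linear _).linear _))

theorem partialD_bivectorContract
    (hP : ∀ i j, DifferentiableAt ℝ
      (fun z => P z ((stdBasis m).coord i) ((stdBasis m).coord j)) y)
    (hF : DiffAt F y) (l : Fin m) :
    partialD l (fun z => bivectorContract (stdBasis m) (P z) (F z)) y =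
      bivectorContract (stdBasis m) (P y) (partialD l F y) + derivContract P y l (F y) := by
  have hc : ∀ i j, DiffAt (fun z => leftContract (stdBasis m i)
      (leftContract (stdBasis m j) (F z))) y := fun i j => (hF.linear _).linear _
  have hc' : ∀ i j, partialD l (fun z => leftContract (stdBasis m i)
      (leftContract (stdBasis m j) (F z))) y = leftContract (stdBasis m i)
        (leftContract (stdBasis m j) (partialD l F y)) := fun i j => by
    rw [partialD_linear (hF.linear _), partialD_linear hF]
  simp only [bivectorContract_apply]
  rw [partialD_smul (differentiableAt_const _) (DiffAt.sum _ fun i _ => DiffAt.sum _ fun j _ =>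
    DiffAt.smul (hP i j) (hc i j))]
  rw [partialD_sum _ fun i _ => DiffAt.sum _ fun j _ => DiffAt.smul (hP i j) (hc i j)]
  simp only [partialD_sum Finset.univ (fun j _ => DiffAt.smul (hP _ j) (hc _ j)),
    partialD_smul (hP _ _) (hc _ _), hc', derivContract, LinearMap.smul_apply, LinearMap.sum_apply,
    LinearMap.comp_apply, Finset.sum_add_distrib, smul_add, fderiv_fun_const, Pi.zero_apply,
    zero_apply, zero_smul, zero_add]
  exact add_comm _ _

/-- The coordinate expression of Koszul's operator `[w⊢, d]`. -/
theorem bivectorContract_extD_sub (hA : (P y).IsAlt)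
    (hP : ∀ i j, DifferentiableAt ℝ
      (fun z => P z ((stdBasis m).coord i) ((stdBasis m).coord j)) y)
    (hF : DiffAt F y) :
    bivectorContract (stdBasis m) (P y) (extD F y) -
      extD (fun z => bivectorContract (stdBasis m) (P z) (F z)) y =
      ∑ l, (hamContract (P y) l (partialD l F y) - dx l * derivContract P y l (F y)) := by
  simp only [extD, map_sum, bivectorContract_dx_mul hA, partialD_bivectorContract hP hF, mul_add,
    Finset.sum_add_distrib, Finset.sum_sub_distrib]
  abel

theorem bivectorContract_hamContract
    (w : LinearMap.BilinForm ℝ (Module.Dual ℝ (EuclideanSpace ℝ (Fin m)))) (l : Fin m)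
    (a : Ext ℝ (EuclideanSpace ℝ (Fin m))) :
    bivectorContract (stdBasis m) w (hamContract w l a) =
      hamContract w l (bivectorContract (stdBasis m) w a) := by
  simp only [hamContract, LinearMap.sum_apply, LinearMap.smul_apply, map_sum, map_smul,
    bivectorContract_leftContract]

theorem bivectorContract_derivContract
    (w : LinearMap.BilinForm ℝ (Module.Dual ℝ (EuclideanSpace ℝ (Fin m)))) (l : Fin m)
    (a : Ext ℝ (EuclideanSpace ℝ (Fin m))) :
    bivectorContract (stdBasis m) w (derivContract P y l a) =
      derivContract P y l (bivectorContract (stdBasis m) w a) := by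
  simp only [derivContract, LinearMap.sum_apply, LinearMap.smul_apply, map_sum, map_smul,
    LinearMap.comp_apply, bivectorContract_leftContract]

/-- Contracting a cyclically invariant tensor with one whose cyclic sums vanish gives zero. -/
theorem sum_smul_eq_zero_of_cyclic {κ W : Type*} [Fintype κ] [AddCommGroup W] [Module ℝ W]
    (T : κ → κ → κ → ℝ) (C : κ → κ → κ → W) (hT : ∀ k i j, T k i j + T i j k + T j k i = 0)
    (hC : ∀ k i j, C i j k = C k i j) : ∑ k, ∑ i, ∑ j, T k i j • C k i j = 0 := by
  have h2 : ∑ k, ∑ i, ∑ j, T i j k • C k i j = ∑ k, ∑ i, ∑ j, T k i j • C k i j := by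
    calc ∑ k, ∑ i, ∑ j, T i j k • C k i j = ∑ k, ∑ i, ∑ j, T i j k • C i j k := by simp only [hC]
      _ = ∑ i, ∑ k, ∑ j, T i j k • C i j k := Finset.sum_comm
      _ = _ := Finset.sum_congr rfl fun i _ => Finset.sum_comm
  have h3 : ∑ k, ∑ i, ∑ j, T j k i • C k i j = ∑ k, ∑ i, ∑ j, T k i j • C k i j := by
    calc ∑ k, ∑ i, ∑ j, T j k i • C k i j = ∑ k, ∑ i, ∑ j, T j k i • C j k i :=
          Finset.sum_congr rfl fun k _ => Finset.sum_congr rfl fun i _ =>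
            Finset.sum_congr rfl fun j _ => by rw [hC j k i]
      _ = ∑ k, ∑ j, ∑ i, T j k i • C j k i := Finset.sum_congr rfl fun i _ => Finset.sum_comm
      _ = _ := Finset.sum_comm
  -- The three cyclic rearrangements of the sum are equal, and they add up to zero.
  have h4 : ∑ k, ∑ i, ∑ j, T k i j • C k i j + ∑ k, ∑ i, ∑ j, T i j k • C k i j +
      ∑ k, ∑ i, ∑ j, T j k i • C k i j = 0 := by
    simp only [← Finset.sum_add_distrib, ← add_smul, hT, zero_smul, Finset.sum_const_zero]
  rw [h2, h3] at h4
  have h5 : (3 : ℝ) • ∑ k, ∑ i, ∑ j, T k i j • C k i j = 0 := by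
    rw [← h4]
    module
  exact (smul_eq_zero.mp h5).resolve_left (by norm_num)

/-- The sum `∑ₗ X_l ⊢ (∂ₗw ⊢ ·)`, with `X_l = ∑ᵢ wⁱˡ eᵢ`, is a multiple of the contraction with
`[w, w]`: triple contractions are invariant under cyclic permutations, so that only the cyclic sums
of `∑ₗ wᵃˡ ∂ₗwⁱʲ` matter. -/
theorem sum_hamContract_derivContract (hA : (P y).IsAlt)
    (hJ : ∀ i j k, ∑ l, (
      P y ((stdBasis m).coord l) ((stdBasis m).coord k) * fderiv ℝ
        (fun z => P z ((stdBasis m).coord i) ((stdBasis m).coord j)) y (stdBasis m l) +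
      P y ((stdBasis m).coord l) ((stdBasis m).coord i) * fderiv ℝ
        (fun z => P z ((stdBasis m).coord j) ((stdBasis m).coord k)) y (stdBasis m l) +
      P y ((stdBasis m).coord l) ((stdBasis m).coord j) * fderiv ℝ
        (fun z => P z ((stdBasis m).coord k) ((stdBasis m).coord i)) y (stdBasis m l)) = 0)
    (a : Ext ℝ (EuclideanSpace ℝ (Fin m))) :
    ∑ l, hamContract (P y) l (derivContract P y l a) = 0 := by
  let T : Fin m → Fin m → Fin m → ℝ := fun k i j => ∑ l,
    P y ((stdBasis m).coord l) ((stdBasis m).coord k) * fderiv ℝ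
        (fun z => P z ((stdBasis m).coord i) ((stdBasis m).coord j)) y (stdBasis m l)
  let C : Fin m → Fin m → Fin m → Ext ℝ (EuclideanSpace ℝ (Fin m)) := fun k i j =>
    leftContract (stdBasis m k) (leftContract (stdBasis m i) (leftContract (stdBasis m j) a))
  have hT : ∀ k i j, T k i j + T i j k + T j k i = 0 := fun k i j => by
    simpa only [Finset.sum_add_distrib] using hJ i j k
  have hC : ∀ k i j, C i j k = C k i j := fun k i j => by
    simp only [C]
    rw [leftContract_leftContract (stdBasis m j) (stdBasis m k), map_neg,
      leftContract_leftContract (stdBasis m i) (stdBasis m k), neg_neg]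
  have h1 : ∑ l, hamContract (P y) l (derivContract P y l a) =
      -((2 : ℝ)⁻¹ • ∑ k, ∑ i, ∑ j, T k i j • C k i j) := by
    simp only [hamContract, LinearMap.sum_apply, LinearMap.smul_apply, Finset.smul_sum,
      ← Finset.sum_neg_distrib]
    rw [Finset.sum_comm]
    refine Finset.sum_congr rfl fun k _ => ?_
    simp only [derivContract, LinearMap.sum_apply, LinearMap.smul_apply, map_sum, map_smul,
      LinearMap.comp_apply, Finset.smul_sum]
    rw [Finset.sum_comm]
    refine Finset.sum_congr rfl fun i _ => ?_
    rw [Finset.sum_comm]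
    refine Finset.sum_congr rfl fun j _ => ?_
    simp only [T, Finset.sum_smul, Finset.smul_sum, ← Finset.sum_neg_distrib]
    refine Finset.sum_congr rfl fun l _ => ?_
    rw [← LinearMap.BilinForm.IsAlt.neg_eq hA, smul_smul, smul_smul, smul_smul, ← neg_smul]
    congr 1
    ring
  rw [h1, sum_smul_eq_zero_of_cyclic T C hT hC, smul_zero, neg_zero]

/-- For a Poisson bivector `w` the double commutator `[w⊢, [w⊢, d]]` vanishes. -/
theorem bivectorContract_bivectorContract_extD (hU : IsOpen U) (hy : y ∈ U)
    (hA : (P y).IsAlt) (hP : SmoothOn P U) (hF : SmoothOn F U)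
    (hJ : ∀ i j k, ∑ l, (
      P y ((stdBasis m).coord l) ((stdBasis m).coord k) * fderiv ℝ
        (fun z => P z ((stdBasis m).coord i) ((stdBasis m).coord j)) y (stdBasis m l) +
      P y ((stdBasis m).coord l) ((stdBasis m).coord i) * fderiv ℝ
        (fun z => P z ((stdBasis m).coord j) ((stdBasis m).coord k)) y (stdBasis m l) +
      P y ((stdBasis m).coord l) ((stdBasis m).coord j) * fderiv ℝ
        (fun z => P z ((stdBasis m).coord k) ((stdBasis m).coord i)) y (stdBasis m l)) = 0) :
    bivectorContract (stdBasis m) (P y) (bivectorContract (stdBasis m) (P y) (extD F y) -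
        extD (fun z => bivectorContract (stdBasis m) (P z) (F z)) y) =
      bivectorContract (stdBasis m) (P y)
        (extD (fun z => bivectorContract (stdBasis m) (P z) (F z)) y) -
        extD (fun z => bivectorContract (stdBasis m) (P z)
          (bivectorContract (stdBasis m) (P z) (F z))) y := by
  have hd : ∀ i j, DifferentiableAt ℝ
      (fun z => P z ((stdBasis m).coord i) ((stdBasis m).coord j)) y := fun i j =>
    ((hP (LinearMap.applyₗ ((stdBasis m).coord j) ∘ₗ
      LinearMap.applyₗ ((stdBasis m).coord i))).contDiffAt
        (hU.mem_nhds hy)).differentiableAt (by simp)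
  have hF' := hF.diffAt hU hy
  rw [bivectorContract_extD_sub hA hd hF',
    bivectorContract_extD_sub hA hd (DiffAt.bivectorContract hd hF')]
  simp only [partialD_bivectorContract hd hF', map_sum, map_sub, map_add,
    bivectorContract_dx_mul hA, bivectorContract_hamContract, bivectorContract_derivContract,
    Finset.sum_add_distrib, Finset.sum_sub_distrib, sum_hamContract_derivContract hA hJ]
  abel

end Poisson

end Coordinates

/-! ### Operators on the differential forms of a manifold -/

section Manifold

variable {m : ℕ} {M : Type*} [TopologicalSpace M] [ChartedSpace (EuclideanSpace ℝ (Fin m)) M]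

theorem finite_tangentSpace (x : M) : Module.Finite ℝ (TangentSpace (𝓡 m) x) :=
  Module.Finite.of_basis (tangentBasis m x)

theorem finrank_tangentSpace (x : M) : Module.finrank ℝ (TangentSpace (𝓡 m) x) = m := by
  rw [Module.finrank_eq_card_basis (tangentBasis m x), Fintype.card_fin]

variable [IsManifold (𝓡 m) ∞ M]

/-- The value of a form at a point. -/
def evalAt (x : M) : Form m M →ₗ[ℝ] ExtAt m x where
  toFun α := α.1 x
  map_add' _ _ := rfl
  map_smul' _ _ := rfl

theorem Form.ext_evalAt {α β : Form m M} (h : ∀ x, evalAt x α = evalAt x β) : α = β :=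
  Subtype.ext (funext h)

/-- A form is determined by its expressions in all charts. -/
theorem Form.ext_localForm {α β : Form m M}
    (h : ∀ x₀, ∀ y ∈ (extChartAt (𝓡 m) x₀).target, localForm m α.1 x₀ y = localForm m β.1 x₀ y) :
    α = β := by
  refine Form.ext_evalAt fun x => ?_
  have h1 := h x _ (mem_extChartAt_target x)
  have hx : x ∈ (extChartAt (𝓡 m) x).source := mem_extChartAt_source x
  rw [localForm_apply _ hx, localForm_apply _ hx] at h1
  have h2 := congrArg (pullExt (coordDeriv m x x)) h1
  rwa [pullExt_comp, pullExt_comp, coordFrame_comp_coordDeriv hx, pullExt_id, pullExt_id] at h2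

theorem parity_pullExt {k V V' : Type*} [Field k] [AddCommGroup V] [Module k V] [AddCommGroup V']
    [Module k V'] (L : V →ₗ[k] V') (a : Ext k V') : parity (pullExt L a) = pullExt L (parity a) := by
  induction a using ext_induction with
  | scalar r => simp only [AlgHom.commutes]
  | add a b ha hb => simp only [map_add, ha, hb]
  | ι_mul ξ a h => rw [map_mul, map_mul, map_mul, map_mul, h, pullExt_ι, parity_ι, parity_ι,
      map_neg, pullExt_ι]

/-- The parity involution of `Ω(M)`. -/
def formParity : Form m M →ₗ[ℝ] Form m M where
  toFun α := ⟨fun x => parity (α.1 x), fun x₀ =>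
    (SmoothOn.linear (α.2 x₀) parity.toLinearMap).congr fun _ _ => (parity_pullExt _ _).symm⟩
  map_add' _ _ := Subtype.ext <| funext fun _ => map_add parity _ _
  map_smul' _ _ := Subtype.ext <| funext fun _ => map_smul parity _ _

theorem evalAt_formParity (x : M) (α : Form m M) :
    evalAt x (formParity α) = parity (evalAt x α) := rfl

theorem localForm_formParity (α : Form m M) (x₀ : M) (y : EuclideanSpace ℝ (Fin m)) :
    localForm m (formParity α).1 x₀ y = parity (localForm m α.1 x₀ y) :=
  (parity_pullExt _ _).symm

theorem formParity_formParity (α : Form m M) : formParity (formParity α) = α :=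
  Form.ext_evalAt fun _ => parity_parity _

theorem localForm_extDeriv (α : Form m M) (x₀ : M) {y : EuclideanSpace ℝ (Fin m)}
    (hy : y ∈ (extChartAt (𝓡 m) x₀).target) :
    localForm m (extDeriv α).1 x₀ y = extD (localForm m α.1 x₀) y :=
  localForm_extDerivFun α.2 x₀ hy

/-- The exterior derivative at a point depends only on the germ. -/
theorem extD_congr_on {U : Set (EuclideanSpace ℝ (Fin m))} (hU : IsOpen U)
    {F G : EuclideanSpace ℝ (Fin m) → Ext ℝ (EuclideanSpace ℝ (Fin m))}
    (h : ∀ z ∈ U, F z = G z) {y : EuclideanSpace ℝ (Fin m)} (hy : y ∈ U) :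
    extD F y = extD G y :=
  extD_congr (Filter.eventually_of_mem (hU.mem_nhds hy) h)

theorem extDeriv_extDeriv (α : Form m M) : extDeriv (extDeriv α) = 0 := by
  refine Form.ext_localForm fun x₀ y hy => ?_
  have hU := isOpen_extChartAt_target (I := 𝓡 m) x₀
  rw [localForm_extDeriv _ _ hy, extD_congr_on hU (fun z hz => localForm_extDeriv α x₀ hz) hy,
    extD_extD hU (α.2 x₀) hy]
  exact (map_zero (pullExt _)).symm

theorem parity_extD {F : EuclideanSpace ℝ (Fin m) → Ext ℝ (EuclideanSpace ℝ (Fin m))}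
    {y : EuclideanSpace ℝ (Fin m)} (hF : DiffAt F y) :
    extD (fun z => parity (F z)) y = -parity (extD F y) := by
  simp only [extD, map_sum, map_mul, ← Finset.sum_neg_distrib]
  refine Finset.sum_congr rfl fun i _ => ?_
  rw [dx, parity_ι, neg_mul, neg_neg]
  exact congrArg _ (partialD_linear hF parity.toLinearMap i)

theorem extDeriv_formParity (α : Form m M) :
    extDeriv (formParity α) = -formParity (extDeriv α) := by
  refine Form.ext_localForm fun x₀ y hy => ?_
  have hU := isOpen_extChartAt_target (I := 𝓡 m) x₀
  have h : localForm m (-formParity (extDeriv α) : Form m M).1 x₀ y =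
      -localForm m (formParity (extDeriv α)).1 x₀ y := map_neg (pullExt _) _
  rw [localForm_extDeriv _ _ hy, h, localForm_formParity, localForm_extDeriv _ _ hy,
    ← parity_extD ((α.2 x₀).diffAt hU hy)]
  exact extD_congr_on hU (fun z _ => localForm_formParity α x₀ z) hy

variable (w : BivectorField m M)

theorem localForm_formTerm_zero (α β : Form m M) (x₀ : M) {y : EuclideanSpace ℝ (Fin m)}
    (hy : y ∈ (extChartAt (𝓡 m) x₀).target) :
    localForm m (formTerm w 0 α β).1 x₀ y = localForm m α.1 x₀ y * localForm m β.1 x₀ y :=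
  (localForm_quantumTerm w 0 α.1 β.1 x₀ hy).trans (quantumTerm_zero _ _ _ _)

/-- The Leibniz rule; `formTerm w 0` is the exterior product. -/
theorem extDeriv_formTerm_zero (α β : Form m M) : extDeriv (formTerm w 0 α β) =
    formTerm w 0 (extDeriv α) β + formTerm w 0 (formParity α) (extDeriv β) := by
  refine Form.ext_localForm fun x₀ y hy => ?_
  have hU := isOpen_extChartAt_target (I := 𝓡 m) x₀
  have h : localForm m (formTerm w 0 (extDeriv α) β + formTerm w 0 (formParity α) (extDeriv β) :
      Form m M).1 x₀ y = localForm m (formTerm w 0 (extDeriv α) β).1 x₀ y +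
        localForm m (formTerm w 0 (formParity α) (extDeriv β)).1 x₀ y := map_add (pullExt _) _ _
  rw [localForm_extDeriv _ _ hy,
    extD_congr_on hU (fun z hz => localForm_formTerm_zero w α β x₀ hz) hy,
    extD_mul ((α.2 x₀).diffAt hU hy) ((β.2 x₀).diffAt hU hy), h, localForm_formTerm_zero w _ _ _ hy,
    localForm_formTerm_zero w _ _ _ hy, localForm_formParity, localForm_extDeriv _ _ hy,
    localForm_extDeriv _ _ hy]
  rfl

theorem evalAt_formTerm (n : ℕ) (α β : Form m M) (x : M) : evalAt x (formTerm w n α β) =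
    quantumTerm (tangentBasis m x) (w.toFun x) n (evalAt x α) (evalAt x β) := rfl

theorem evalAt_contract (α : Form m M) (x : M) : evalAt x (contract w α) =
    bivectorContract (tangentBasis m x) (w.toFun x) (evalAt x α) := rfl

theorem formTerm_zero_assoc (α β γ : Form m M) :
    formTerm w 0 (formTerm w 0 α β) γ = formTerm w 0 α (formTerm w 0 β γ) :=
  Form.ext_evalAt fun x => by simp only [evalAt_formTerm, quantumTerm_zero, mul_assoc]

theorem formTerm_zero_comm_even (α β : Form m M) :
    formTerm w 0 α β + formTerm w 0 (formParity α) β =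
      formTerm w 0 β α + formTerm w 0 β (formParity α) :=
  Form.ext_evalAt fun x => by
    simpa only [map_add, evalAt_formTerm, quantumTerm_zero, evalAt_formParity] using
      (add_parity_mul (evalAt x α) (evalAt x β)).1

theorem formTerm_zero_comm_odd (α β : Form m M) :
    formTerm w 0 α β - formTerm w 0 (formParity α) β =
      formTerm w 0 (formParity β) α - formTerm w 0 (formParity β) (formParity α) :=
  Form.ext_evalAt fun x => by
    simpa only [map_sub, evalAt_formTerm, quantumTerm_zero, evalAt_formParity] using
      (add_parity_mul (evalAt x α) (evalAt x β)).2

theorem contract_formParity (α : Form m M) :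
    contract w (formParity α) = formParity (contract w α) :=
  Form.ext_evalAt fun _ => bivectorContract_parity _ _ _

theorem formTerm_eq_zero {n : ℕ} (hn : m < n) : formTerm w n = 0 := by
  refine LinearMap.ext₂ fun α β => Form.ext_evalAt fun x => ?_
  have := finite_tangentSpace (m := m) x
  rw [evalAt_formTerm, quantumTerm_eq_zero _ _ (by rwa [finrank_tangentSpace])]
  rfl

theorem evalAt_neg_contract_pow (n : ℕ) (α : Form m M) (x : M) :
    evalAt x (((-contract w) ^ n) α) =
      ((-bivectorContract (tangentBasis m x) (w.toFun x)) ^ n) (evalAt x α) := by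
  induction n with
  | zero => rfl
  | succ n ih =>
    rw [pow_succ', pow_succ', Module.End.mul_apply, Module.End.mul_apply, ← ih,
      LinearMap.neg_apply, LinearMap.neg_apply, map_neg, evalAt_contract]

theorem evalAt_divPow_neg_contract (n : ℕ) (α : Form m M) (x : M) :
    evalAt x (divPow ℝ (-contract w) n α) =
      divPow ℝ (-bivectorContract (tangentBasis m x) (w.toFun x)) n (evalAt x α) := by
  rw [divPow, divPow, LinearMap.smul_apply, LinearMap.smul_apply, map_smul, evalAt_neg_contract_pow]

theorem neg_contract_pow_eq_zero : (-contract w) ^ (m + 1) = 0 := by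
  refine LinearMap.ext fun α => Form.ext_evalAt fun x => ?_
  have := finite_tangentSpace (m := m) x
  rw [evalAt_neg_contract_pow, neg_bivectorContract_pow_eq_zero _ _
    (by rw [finrank_tangentSpace]; exact Nat.lt_succ_self m)]
  rfl

/-- The fibrewise identity `divPow_bivectorContract_mul`, for forms on `M`. -/
theorem divPow_contract_wedge (N : ℕ) (α β : Form m M) :
    divPow ℝ (-contract w) N (formTerm w 0 α β) =
      ∑ p ∈ Finset.HasAntidiagonal.antidiagonal N,
        ∑ q ∈ Finset.HasAntidiagonal.antidiagonal p.2,
          formTerm w p.1 (divPow ℝ (-contract w) q.1 α) (divPow ℝ (-contract w) q.2 β) :=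
  Form.ext_evalAt fun x => by
    rw [evalAt_divPow_neg_contract, evalAt_formTerm, quantumTerm_zero,
      divPow_bivectorContract_mul _ _ (w.isAlt x)]
    simp only [map_sum, evalAt_formTerm, evalAt_divPow_neg_contract]

theorem localForm_contract (α : Form m M) (x₀ : M) {y : EuclideanSpace ℝ (Fin m)}
    (hy : y ∈ (extChartAt (𝓡 m) x₀).target) : localForm m (contract w α).1 x₀ y =
      bivectorContract (stdBasis m) (localBivector m w.toFun x₀ y) (localForm m α.1 x₀ y) :=
  localForm_bivectorContract w α.1 x₀ hy

/-- On a Poisson manifold `w⊢` commutes with `δ = [w⊢, d]`. -/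
theorem contract_koszulDelta {w : BivectorField m M} (hw : w.IsPoisson) :
    contract w ∘ₗ koszulDelta w = koszulDelta w ∘ₗ contract w := by
  refine LinearMap.ext fun α => Form.ext_localForm fun x₀ y hy => ?_
  have hU := isOpen_extChartAt_target (I := 𝓡 m) x₀
  have hδ : ∀ γ : Form m M, localForm m (koszulDelta w γ).1 x₀ y =
      localForm m (contract w (extDeriv γ)).1 x₀ y -
        localForm m (extDeriv (contract w γ)).1 x₀ y := fun γ => map_sub (pullExt _) _ _
  have hA : (localBivector m w.toFun x₀ y).IsAlt := fun ξ => w.isAlt _ _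
  rw [LinearMap.comp_apply, LinearMap.comp_apply, localForm_contract w _ _ hy, hδ, hδ,
    localForm_contract w _ _ hy, localForm_contract w _ _ hy, localForm_extDeriv _ _ hy,
    localForm_extDeriv _ _ hy, localForm_extDeriv _ _ hy]
  have h1 : ∀ z ∈ (extChartAt (𝓡 m) x₀).target, localForm m (contract w (contract w α)).1 x₀ z =
      bivectorContract (stdBasis m) (localBivector m w.toFun x₀ z)
        (bivectorContract (stdBasis m) (localBivector m w.toFun x₀ z) (localForm m α.1 x₀ z)) :=
    fun z hz => by rw [localForm_contract w _ _ hz, localForm_contract w _ _ hz]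
  rw [extD_congr_on hU (fun z hz => localForm_contract w α x₀ hz) hy, extD_congr_on hU h1 hy]
  refine bivectorContract_bivectorContract_extD hU hy hA (w.smooth x₀) (α.2 x₀) fun i j k => ?_
  have h := hw x₀ y hy i j k
  simp only [schoutenBracket, ← two_mul, ← Finset.mul_sum, ← mul_add] at h
  have h' := (mul_eq_zero.mp h).resolve_left two_ne_zero
  rw [Finset.sum_add_distrib, Finset.sum_add_distrib]
  exact h'

end Manifold

/-! ### Exponentials of nilpotent operators -/

section Exponential

variable {k R : Type*} [Field k] [Ring R] [Algebra k R]

/-- The exponential series of `x`, cut off at `xᴷ`; it is the exponential of `x` when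
`xᴷ = 0`. -/
def expSum (k : Type*) {R : Type*} [Field k] [Ring R] [Algebra k R] (K : ℕ) (x : R) : R :=
  ∑ n ∈ Finset.range K, divPow k x n

theorem expSum_eq_of_le {x : R} {K K' : ℕ} (hx : x ^ K = 0) (h : K ≤ K') :
    expSum k K x = expSum k K' x := by
  refine Finset.sum_subset (fun n hn => ?_) fun n _ hn => ?_
  · simp only [Finset.mem_range] at hn ⊢
    omega
  · exact divPow_eq_zero hx (not_lt.mp fun h => hn (Finset.mem_range.mpr h))

theorem expSum_mul_expSum_neg [CharZero k] {x : R} {K : ℕ} (hx : x ^ K = 0) :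
    expSum k K x * expSum k K (-x) = 1 := by
  have hx' : (-x) ^ K = 0 := by rw [neg_pow, hx, mul_zero]
  have h := sum_range_antidiagonal (fun p => divPow k x p.1 * divPow k (-x) p.2)
    (K₁ := K) (K₂ := K) (K := K + K + 1) (Nat.le_succ _)
    (fun p hp => by rw [divPow_eq_zero hx hp, zero_mul])
    (fun p hp => by rw [divPow_eq_zero hx' hp, mul_zero])
  simp only [← divPow_add (Commute.neg_right (Commute.refl x)), add_neg_cancel] at h
  rw [expSum, expSum, Finset.sum_mul_sum, ← h, Finset.sum_range_succ', divPow_zero,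
    Finset.sum_eq_zero, zero_add]
  intro n _
  rw [divPow, zero_pow n.succ_ne_zero, smul_zero]

/-- If `[x, [x, d]] = 0` then `exp(x) d exp(-x) = d + [x, d]`. -/
theorem expSum_mul_of_commute [CharZero k] {x d δ : R} {K : ℕ} (hx : x ^ K = 0)
    (hd : x * d = d * x + δ) (hδ : Commute x δ) :
    expSum k K x * d = (d + δ) * expSum k K x := by
  have hpow : ∀ n : ℕ, x ^ (n + 1) * d = d * x ^ (n + 1) + ((n + 1 : ℕ) : k) • (δ * x ^ n) := by
    intro n
    induction n with
    | zero => simp [hd]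
    | succ n ih =>
      rw [pow_succ', mul_assoc, ih, mul_add, mul_smul_comm, ← mul_assoc, ← mul_assoc, hd,
        add_mul, hδ.eq, mul_assoc, mul_assoc δ, ← pow_succ', ← pow_succ', add_assoc]
      congr 1
      push_cast
      module
  have hdiv : ∀ n, divPow k x (n + 1) * d = d * divPow k x (n + 1) + δ * divPow k x n := by
    intro n
    rw [divPow, smul_mul_assoc, hpow, divPow, mul_smul_comm, mul_smul_comm, smul_add, smul_smul]
    congr 2
    rw [Nat.factorial_succ, Nat.cast_mul, mul_inv, mul_comm, ← mul_assoc,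
      mul_inv_cancel₀ (Nat.cast_ne_zero.mpr n.succ_ne_zero), one_mul]
  have hK : expSum k K x = expSum k (K + 1) x := expSum_eq_of_le hx K.le_succ
  have h1 : expSum k (K + 1) x = ∑ n ∈ Finset.range K, divPow k x (n + 1) + 1 := by
    rw [expSum, Finset.sum_range_succ', divPow_zero]
  conv_lhs => rw [hK, h1, add_mul, Finset.sum_mul]
  simp only [hdiv, Finset.sum_add_distrib, ← Finset.mul_sum]
  rw [add_mul]
  conv_rhs => rw [hK, h1, ← h1, ← hK]
  rw [one_mul, add_right_comm]
  congr 1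
  rw [hK, h1, mul_add, mul_one]

end Exponential

/-! ### The equivalence with the undeformed complex -/

section QuantumForm

variable {m : ℕ} {M : Type*} [TopologicalSpace M] [ChartedSpace (EuclideanSpace ℝ (Fin m)) M]
  [IsManifold (𝓡 m) ∞ M] (w : BivectorField m M) (A : Type*) [CommRing A] [Algebra ℝ A] (h : A)

/-- The operator `-h w⊢` on `Ω(M) ⊗ A`. -/
def negContract : Module.End ℝ (QuantumForm m M A) :=
  TensorProduct.map (-contract w) (LinearMap.mulLeft ℝ h)

/-- The operator `exp(-h w⊢)` on `Ω(M) ⊗ A`. -/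
def expContract : Module.End ℝ (QuantumForm m M A) := expSum ℝ (m + 1) (negContract w A h)

variable (m M) in
/-- The undeformed differential `d ⊗ 1`. -/
def classicalD : Module.End ℝ (QuantumForm m M A) := TensorProduct.map extDeriv LinearMap.id

/-- The undeformed product on `Ω(M) ⊗ A`. -/
def classicalWedge : QuantumForm m M A →ₗ[ℝ] QuantumForm m M A →ₗ[ℝ] QuantumForm m M A :=
  TensorProduct.map₂ (formTerm w 0) (LinearMap.mul ℝ A)

variable (m M) in
/-- The parity involution of `Ω(M) ⊗ A`; powers of `h` are even. -/
def quantumParity : Module.End ℝ (QuantumForm m M A) :=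
  TensorProduct.map formParity LinearMap.id

variable {A}

theorem classicalD_tmul (α : Form m M) (a : A) :
    classicalD m M A (α ⊗ₜ a) = extDeriv α ⊗ₜ a := rfl

theorem quantumParity_tmul (α : Form m M) (a : A) :
    quantumParity m M A (α ⊗ₜ a) = formParity α ⊗ₜ a := rfl

theorem classicalWedge_tmul (α β : Form m M) (a b : A) :
    classicalWedge w A (α ⊗ₜ a) (β ⊗ₜ b) = formTerm w 0 α β ⊗ₜ (a * b) := rfl

theorem negContract_tmul (α : Form m M) (a : A) :
    negContract w A h (α ⊗ₜ a) = (-contract w) α ⊗ₜ (h * a) := rfl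

theorem negContract_pow_tmul (n : ℕ) (α : Form m M) (a : A) :
    (negContract w A h ^ n) (α ⊗ₜ a) = ((-contract w) ^ n) α ⊗ₜ (h ^ n * a) := by
  induction n with
  | zero => simp
  | succ n ih => rw [pow_succ', Module.End.mul_apply, ih, negContract_tmul, pow_succ', pow_succ',
      Module.End.mul_apply, mul_assoc]

theorem negContract_pow_eq_zero : negContract w A h ^ (m + 1) = 0 :=
  TensorProduct.ext' fun α a => by
    rw [negContract_pow_tmul, neg_contract_pow_eq_zero]
    simp

theorem divPow_negContract_tmul (n : ℕ) (α : Form m M) (a : A) :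
    divPow ℝ (negContract w A h) n (α ⊗ₜ a) = divPow ℝ (-contract w) n α ⊗ₜ (h ^ n * a) := by
  rw [divPow, LinearMap.smul_apply, negContract_pow_tmul, divPow, LinearMap.smul_apply,
    TensorProduct.smul_tmul']

theorem expContract_tmul {K : ℕ} (hK : m + 1 ≤ K) (α : Form m M) (a : A) :
    expContract w A h (α ⊗ₜ a) =
      ∑ n ∈ Finset.range K, divPow ℝ (-contract w) n α ⊗ₜ (h ^ n * a) := by
  rw [expContract, expSum_eq_of_le (negContract_pow_eq_zero w h) hK, expSum, LinearMap.sum_apply]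
  exact Finset.sum_congr rfl fun n _ => divPow_negContract_tmul w h n α a

theorem expContract_surjective : Function.Surjective (expContract w A h) := fun x =>
  ⟨expSum ℝ (m + 1) (-negContract w A h) x,
    LinearMap.congr_fun (expSum_mul_expSum_neg (k := ℝ) (negContract_pow_eq_zero w h)) x⟩

/-- The quantum differential is conjugate to the classical one:
`d - hδ = exp(-h w⊢) d exp(h w⊢)`. -/
theorem quantumD_expContract (hw : w.IsPoisson) (x : QuantumForm m M A) :
    quantumD w A h (expContract w A h x) = expContract w A h (classicalD m M A x) := by
  let δ : Module.End ℝ (QuantumForm m M A) :=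
    -TensorProduct.map (koszulDelta w) (LinearMap.mulLeft ℝ h)
  have hq : quantumD w A h = classicalD m M A + δ := sub_eq_add_neg _ _
  have h1 : negContract w A h * classicalD m M A = classicalD m M A * negContract w A h + δ := by
    refine TensorProduct.ext' fun α a => ?_
    have hδ : koszulDelta w α = contract w (extDeriv α) - extDeriv (contract w α) := rfl
    simp only [δ, Module.End.mul_apply, LinearMap.add_apply, LinearMap.neg_apply, classicalD_tmul,
      negContract_tmul, TensorProduct.map_tmul, LinearMap.mulLeft_apply, hδ, map_neg,
      TensorProduct.sub_tmul, TensorProduct.neg_tmul]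
    abel
  have h2 : Commute (negContract w A h) δ := by
    refine TensorProduct.ext' fun α a => ?_
    have hc := LinearMap.congr_fun (contract_koszulDelta hw) α
    simp only [LinearMap.comp_apply] at hc
    simp only [δ, Module.End.mul_apply, negContract_tmul, TensorProduct.map_tmul,
      LinearMap.mulLeft_apply, LinearMap.neg_apply, hc, map_neg]
  have h3 := expSum_mul_of_commute (k := ℝ) (negContract_pow_eq_zero w h) h1 h2
  rw [← hq] at h3
  exact (LinearMap.congr_fun h3 x).symm

theorem quantumWedge_tmul (α β : Form m M) (a b : A) :
    quantumWedge w A h (α ⊗ₜ a) (β ⊗ₜ b) =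
      ∑ n ∈ Finset.range (m + 1), formTerm w n α β ⊗ₜ (h ^ n * (a * b)) := by
  simp only [quantumWedge, LinearMap.sum_apply]
  rfl

/-- The quantum product is conjugate to the classical one:
`exp(-h w⊢)(x ∧ y) = (exp(-h w⊢) x) ∧ₕ (exp(-h w⊢) y)`. -/
theorem quantumWedge_expContract (x y : QuantumForm m M A) :
    quantumWedge w A h (expContract w A h x) (expContract w A h y) =
      expContract w A h (classicalWedge w A x y) := by
  have hs : ∀ {n : ℕ}, m + 1 ≤ n → divPow ℝ (-contract w) n = 0 :=
    divPow_eq_zero (neg_contract_pow_eq_zero w)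
  suffices H : (quantumWedge w A h).compl₁₂ (expContract w A h) (expContract w A h) =
      (classicalWedge w A).compr₂ (expContract w A h) from LinearMap.congr_fun₂ H x y
  refine TensorProduct.ext' fun α a => TensorProduct.ext' fun β b => ?_
  simp only [LinearMap.compl₁₂_apply, LinearMap.compr₂_apply]
  let f : ℕ → ℕ × ℕ → QuantumForm m M A := fun n q =>
    formTerm w n (divPow ℝ (-contract w) q.1 α) (divPow ℝ (-contract w) q.2 β) ⊗ₜ
      (h ^ (n + (q.1 + q.2)) * (a * b))
  have hf₁ : ∀ n q, m + 1 ≤ q.1 → f n q = 0 := fun n q hq => by simp [f, hs hq]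
  have hf₂ : ∀ n q, m + 1 ≤ q.2 → f n q = 0 := fun n q hq => by simp [f, hs hq]
  have hl : quantumWedge w A h (expContract w A h (α ⊗ₜ a)) (expContract w A h (β ⊗ₜ b)) =
      ∑ n ∈ Finset.range (m + 1), ∑ i ∈ Finset.range (m + 1), ∑ j ∈ Finset.range (m + 1),
        f n (i, j) := by
    rw [expContract_tmul w h le_rfl, expContract_tmul w h le_rfl]
    simp only [map_sum, LinearMap.sum_apply, quantumWedge_tmul]
    rw [Finset.sum_comm]
    conv_rhs => rw [Finset.sum_comm]
    refine Finset.sum_congr rfl fun i _ => ?_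
    rw [Finset.sum_comm]
    refine Finset.sum_congr rfl fun n _ => Finset.sum_congr rfl fun j _ => ?_
    simp only [f]
    congr 1
    ring
  -- Terms with an index above `m` vanish, so that `3(m + 1)` bounds the total degree.
  have hr : expContract w A h (classicalWedge w A (α ⊗ₜ a) (β ⊗ₜ b)) =
      ∑ N ∈ Finset.range (m + 1 + (m + 1 + (m + 1))),
        ∑ p ∈ Finset.HasAntidiagonal.antidiagonal N,
          ∑ q ∈ Finset.HasAntidiagonal.antidiagonal p.2, f p.1 q := by
    rw [classicalWedge_tmul, expContract_tmul w h (K := m + 1 + (m + 1 + (m + 1))) (by omega)]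
    refine Finset.sum_congr rfl fun N _ => ?_
    rw [divPow_contract_wedge, TensorProduct.sum_tmul]
    refine Finset.sum_congr rfl fun p hp => ?_
    rw [TensorProduct.sum_tmul]
    refine Finset.sum_congr rfl fun q hq => ?_
    rw [Finset.HasAntidiagonal.mem_antidiagonal] at hp hq
    simp only [f, hq, hp]
  rw [hl, hr, sum_range_antidiagonal (K₁ := m + 1) (K₂ := m + 1 + (m + 1)) _ le_rfl]
  · exact Finset.sum_congr rfl fun n _ => (sum_range_antidiagonal (f n) le_rfl (hf₁ n) (hf₂ n)).symm
  · intro p hp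
    exact Finset.sum_eq_zero fun q _ => by simp [f, formTerm_eq_zero w hp]
  · intro p hp
    refine Finset.sum_eq_zero fun q hq => ?_
    rw [Finset.HasAntidiagonal.mem_antidiagonal] at hq
    rcases le_or_gt (m + 1) q.1 with h1 | h1
    · exact hf₁ _ _ h1
    · exact hf₂ _ _ (by omega)

theorem quantumParity_expContract (x : QuantumForm m M A) :
    quantumParity m M A (expContract w A h x) = expContract w A h (quantumParity m M A x) := by
  have h1 : Commute (quantumParity m M A) (negContract w A h) :=
    TensorProduct.ext' fun α a => by
      simp only [Module.End.mul_apply, quantumParity_tmul, negContract_tmul, LinearMap.neg_apply,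
        map_neg, contract_formParity]
  have h2 : Commute (quantumParity m M A) (expContract w A h) :=
    Commute.sum_right _ _ _ fun n _ => (h1.pow_right n).smul_right _
  exact LinearMap.congr_fun h2 x

theorem classicalD_classicalD (x : QuantumForm m M A) :
    classicalD m M A (classicalD m M A x) = 0 := by
  induction x using TensorProduct.induction_on with
  | zero => simp
  | add x y hx hy => rw [map_add, map_add, hx, hy, add_zero]
  | tmul α a => rw [classicalD_tmul, classicalD_tmul, extDeriv_extDeriv, TensorProduct.zero_tmul]

theorem classicalD_classicalWedge (x y : QuantumForm m M A) :
    classicalD m M A (classicalWedge w A x y) = classicalWedge w A (classicalD m M A x) y +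
      classicalWedge w A (quantumParity m M A x) (classicalD m M A y) := by
  suffices H : (classicalWedge w A).compr₂ (classicalD m M A) =
      (classicalWedge w A) ∘ₗ (classicalD m M A) +
      (classicalWedge w A).compl₁₂ (quantumParity m M A) (classicalD m M A) from
    LinearMap.congr_fun₂ H x y
  refine TensorProduct.ext' fun α a => TensorProduct.ext' fun β b => ?_
  simp only [LinearMap.compr₂_apply, LinearMap.add_apply, LinearMap.comp_apply,
    LinearMap.compl₁₂_apply, classicalD_tmul, classicalWedge_tmul, quantumParity_tmul,
    extDeriv_formTerm_zero, TensorProduct.add_tmul]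

theorem classicalD_quantumParity (x : QuantumForm m M A) :
    classicalD m M A (quantumParity m M A x) = -quantumParity m M A (classicalD m M A x) := by
  induction x using TensorProduct.induction_on with
  | zero => simp
  | add x y hx hy => simp only [map_add, hx, hy, neg_add]
  | tmul α a => rw [quantumParity_tmul, classicalD_tmul, classicalD_tmul, quantumParity_tmul,
      extDeriv_formParity, TensorProduct.neg_tmul]

theorem classicalWedge_assoc (x y z : QuantumForm m M A) :
    classicalWedge w A (classicalWedge w A x y) z =
      classicalWedge w A x (classicalWedge w A y z) := by
  induction x using TensorProduct.induction_on with
  | zero => simp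
  | add x x' hx hx' => simp only [map_add, LinearMap.add_apply, hx, hx']
  | tmul α a =>
    induction y using TensorProduct.induction_on with
    | zero => simp
    | add y y' hy hy' => simp only [map_add, LinearMap.add_apply, hy, hy']
    | tmul β b =>
      induction z using TensorProduct.induction_on with
      | zero => simp
      | add z z' hz hz' => simp only [map_add, hz, hz']
      | tmul γ c => simp only [classicalWedge_tmul, formTerm_zero_assoc, mul_assoc]

theorem classicalWedge_comm_even (x y : QuantumForm m M A) :
    classicalWedge w A x y + classicalWedge w A (quantumParity m M A x) y =
      classicalWedge w A y x + classicalWedge w A y (quantumParity m M A x) := by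
  suffices H : classicalWedge w A + classicalWedge w A ∘ₗ quantumParity m M A =
      (classicalWedge w A).flip + (classicalWedge w A).flip ∘ₗ quantumParity m M A from
    LinearMap.congr_fun₂ H x y
  refine TensorProduct.ext' fun α a => TensorProduct.ext' fun β b => ?_
  simp only [LinearMap.add_apply, LinearMap.comp_apply, LinearMap.flip_apply, classicalWedge_tmul,
    quantumParity_tmul, mul_comm b a, ← TensorProduct.add_tmul, formTerm_zero_comm_even]

theorem classicalWedge_comm_odd (x y : QuantumForm m M A) :
    classicalWedge w A x y - classicalWedge w A (quantumParity m M A x) y =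
      classicalWedge w A (quantumParity m M A y) x -
        classicalWedge w A (quantumParity m M A y) (quantumParity m M A x) := by
  suffices H : classicalWedge w A - classicalWedge w A ∘ₗ quantumParity m M A =
      (classicalWedge w A ∘ₗ quantumParity m M A).flip -
        (classicalWedge w A ∘ₗ quantumParity m M A).flip ∘ₗ quantumParity m M A from
    LinearMap.congr_fun₂ H x y
  refine TensorProduct.ext' fun α a => TensorProduct.ext' fun β b => ?_
  simp only [LinearMap.sub_apply, LinearMap.comp_apply, LinearMap.flip_apply, classicalWedge_tmul,
    quantumParity_tmul, mul_comm b a, ← TensorProduct.sub_tmul, formTerm_zero_comm_odd]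

/-! ### The quantum exterior algebra -/

variable {w}

theorem quantumD_quantumD (hw : w.IsPoisson) (x : QuantumForm m M A) :
    quantumD w A h (quantumD w A h x) = 0 := by
  obtain ⟨x, rfl⟩ := expContract_surjective w h x
  rw [quantumD_expContract w h hw, quantumD_expContract w h hw, classicalD_classicalD, map_zero]

theorem quantumD_quantumWedge (hw : w.IsPoisson) (x y : QuantumForm m M A) :
    quantumD w A h (quantumWedge w A h x y) = quantumWedge w A h (quantumD w A h x) y +
      quantumWedge w A h (quantumParity m M A x) (quantumD w A h y) := by
  obtain ⟨x, rfl⟩ := expContract_surjective w h x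
  obtain ⟨y, rfl⟩ := expContract_surjective w h y
  simp only [quantumD_expContract w h hw, quantumWedge_expContract, quantumParity_expContract,
    classicalD_classicalWedge, map_add]

theorem quantumD_quantumParity (hw : w.IsPoisson) (x : QuantumForm m M A) :
    quantumD w A h (quantumParity m M A x) = -quantumParity m M A (quantumD w A h x) := by
  obtain ⟨x, rfl⟩ := expContract_surjective w h x
  simp only [quantumD_expContract w h hw, quantumParity_expContract, classicalD_quantumParity,
    map_neg]

variable (w)

theorem quantumWedge_assoc (x y z : QuantumForm m M A) :
    quantumWedge w A h (quantumWedge w A h x y) z =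
      quantumWedge w A h x (quantumWedge w A h y z) := by
  obtain ⟨x, rfl⟩ := expContract_surjective w h x
  obtain ⟨y, rfl⟩ := expContract_surjective w h y
  obtain ⟨z, rfl⟩ := expContract_surjective w h z
  simp only [quantumWedge_expContract, classicalWedge_assoc]

theorem quantumWedge_comm_even (x y : QuantumForm m M A) :
    quantumWedge w A h x y + quantumWedge w A h (quantumParity m M A x) y =
      quantumWedge w A h y x + quantumWedge w A h y (quantumParity m M A x) := by
  obtain ⟨x, rfl⟩ := expContract_surjective w h x
  obtain ⟨y, rfl⟩ := expContract_surjective w h y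
  simp only [quantumWedge_expContract, quantumParity_expContract, ← map_add,
    classicalWedge_comm_even]

theorem quantumWedge_comm_odd (x y : QuantumForm m M A) :
    quantumWedge w A h x y - quantumWedge w A h (quantumParity m M A x) y =
      quantumWedge w A h (quantumParity m M A y) x -
        quantumWedge w A h (quantumParity m M A y) (quantumParity m M A x) := by
  obtain ⟨x, rfl⟩ := expContract_surjective w h x
  obtain ⟨y, rfl⟩ := expContract_surjective w h y
  simp only [quantumWedge_expContract, quantumParity_expContract, ← map_sub,
    classicalWedge_comm_odd]

theorem quantumWedge_supercomm {r s : ℤ} {x y : QuantumForm m M A}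
    (hx : quantumParity m M A x = (-1 : ℝ) ^ r • x)
    (hy : quantumParity m M A y = (-1 : ℝ) ^ s • y) :
    quantumWedge w A h x y = (-1 : ℝ) ^ (r * s) • quantumWedge w A h y x := by
  rw [zpow_mul]
  rcases Int.even_or_odd r with hr | hr
  · have h1 := quantumWedge_comm_even w h x y
    rw [hr.neg_one_zpow, one_smul] at hx
    rw [hx, ← two_smul ℝ, ← two_smul ℝ (quantumWedge w A h y x)] at h1
    rw [hr.neg_one_zpow, one_zpow, one_smul]
    exact smul_right_injective _ (two_ne_zero' ℝ) h1
  · have h1 := quantumWedge_comm_odd w h x y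
    rw [hr.neg_one_zpow, neg_one_smul] at hx
    rw [hx, hy] at h1
    simp only [map_neg, LinearMap.neg_apply, sub_neg_eq_add, map_smul, LinearMap.smul_apply,
      ← two_smul ℝ] at h1
    rw [hr.neg_one_zpow]
    exact smul_right_injective _ (two_ne_zero' ℝ) h1

variable (m M) in
theorem quantumParity_of_mem_formDegree {κ : Type*} {hpow : κ → A} {e : κ → ℤ} {n : ℤ}
    {x : QuantumForm m M A} (hx : x ∈ formDegree m M hpow e n) :
    quantumParity m M A x = (-1 : ℝ) ^ n • x := by
  induction hx using Submodule.span_induction with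
  | zero => simp
  | add x y _ _ hx hy => rw [map_add, hx, hy, smul_add]
  | smul c x _ hx => rw [map_smul, hx, smul_comm]
  | mem x hx =>
    obtain ⟨q, θ, i, hθ, rfl, rfl⟩ := hx
    have h1 : formParity θ = (-1 : ℝ) ^ q • θ :=
      Form.ext_evalAt fun p => parity_eq_of_mem (hθ p)
    have h2 : Even (2 * e i) := even_two_mul _
    rw [quantumParity_tmul, h1, TensorProduct.smul_tmul', zpow_add₀ (by norm_num), zpow_natCast,
      h2.neg_one_zpow, mul_one]

end QuantumForm

/-! ### Products on cohomology -/

section Cohomology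

/-- A bilinear map for which an operator `D` satisfies a twisted Leibniz rule descends to
`ker D / im D`. -/
theorem exists_product_of_leibniz {X : Type*} [AddCommGroup X] [Module ℝ X] (D : Module.End ℝ X)
    (B : X →ₗ[ℝ] X →ₗ[ℝ] X) (σ : Module.End ℝ X)
    (hB : ∀ x y, D (B x y) = B (D x) y + B (σ x) (D y)) (hσ : ∀ x, D (σ x) = -σ (D x))
    (hσσ : ∀ x, σ (σ x) = x) :
    ∃ μ : (LinearMap.ker D ⧸ (LinearMap.range D).submoduleOf (LinearMap.ker D)) →ₗ[ℝ]
        (LinearMap.ker D ⧸ (LinearMap.range D).submoduleOf (LinearMap.ker D)) →ₗ[ℝ]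
          (LinearMap.ker D ⧸ (LinearMap.range D).submoduleOf (LinearMap.ker D)),
      ∀ (x y : X) (hx : D x = 0) (hy : D y = 0) (hxy : D (B x y) = 0),
        μ (Submodule.Quotient.mk ⟨x, hx⟩) (Submodule.Quotient.mk ⟨y, hy⟩) =
          Submodule.Quotient.mk ⟨B x y, hxy⟩ := by
  set p := (LinearMap.range D).submoduleOf (LinearMap.ker D)
  have hc : ∀ x y : LinearMap.ker D, D (B x y) = 0 := fun x y => by
    have hx : D x = 0 := x.2
    have hy : D y = 0 := y.2
    simp [hB, hx, hy]
  let β : LinearMap.ker D →ₗ[ℝ] LinearMap.ker D →ₗ[ℝ] (LinearMap.ker D ⧸ p) :=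
    LinearMap.mk₂ ℝ (fun x y => p.mkQ ⟨B x y, hc x y⟩)
      (fun x x' y => by
        rw [← map_add]
        exact congrArg _ (Subtype.ext (LinearMap.map_add₂ B _ _ _)))
      (fun c x y => by
        rw [← map_smul]
        exact congrArg _ (Subtype.ext (LinearMap.map_smul₂ B _ _ _)))
      (fun x y y' => by
        rw [← map_add]
        exact congrArg _ (Subtype.ext (map_add (B x) _ _)))
      (fun c x y => by
        rw [← map_smul]
        exact congrArg _ (Subtype.ext (map_smul (B x) _ _)))
  have h1 : p ≤ LinearMap.ker β := by
    rintro ⟨x, hx⟩ ⟨z, rfl⟩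
    refine LinearMap.ext fun y => ?_
    refine (Submodule.Quotient.mk_eq_zero p).mpr ⟨B z y, ?_⟩
    have hy : D y = 0 := y.2
    simp [hB, hy]
  let γ : LinearMap.ker D →ₗ[ℝ] (LinearMap.ker D ⧸ p) →ₗ[ℝ] (LinearMap.ker D ⧸ p) :=
    (p.liftQ β h1).flip
  have h2 : p ≤ LinearMap.ker γ := by
    rintro ⟨y, hy⟩ ⟨z, rfl⟩
    refine LinearMap.ext fun q => ?_
    obtain ⟨x, rfl⟩ := p.mkQ_surjective q
    -- The twist by `σ` is undone by the one in the Leibniz rule.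
    refine (Submodule.Quotient.mk_eq_zero p).mpr ⟨B (σ x) z, ?_⟩
    have hx : D x = 0 := x.2
    simp [hB, hσ, hσσ, hx]
  exact ⟨(p.liftQ γ h2).flip, fun x y hx hy hxy => rfl⟩

variable {m : ℕ} {M : Type*} [TopologicalSpace M] [ChartedSpace (EuclideanSpace ℝ (Fin m)) M]
  [IsManifold (𝓡 m) ∞ M] {w : BivectorField m M} {A : Type*} [CommRing A] [Algebra ℝ A] (h : A)

theorem quantumParity_quantumParity (x : QuantumForm m M A) :
    quantumParity m M A (quantumParity m M A x) = x := by
  induction x using TensorProduct.induction_on with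
  | zero => simp
  | add x y hx hy => rw [map_add, map_add, hx, hy]
  | tmul α a => rw [quantumParity_tmul, quantumParity_tmul, formParity_formParity]

/-- Quantum de Rham cohomology with coefficients in any commutative `ℝ`-algebra `A`, deformation
parameter any `h : A`, and degrees measured by any family of elements of `A`. -/
theorem quantumCohomology_product (hw : w.IsPoisson) {κ : Type*} (hpow : κ → A) (e : κ → ℤ) :
    quantumD w A h ∘ₗ quantumD w A h = 0 ∧
      ∃! μ : QuantumCohomology w A h →ₗ[ℝ] QuantumCohomology w A h →ₗ[ℝ] QuantumCohomology w A h,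
        (∀ (α β : QuantumForm m M A) (hα : quantumD w A h α = 0) (hβ : quantumD w A h β = 0),
          ∃ hαβ : quantumD w A h (quantumWedge w A h α β) = 0,
            μ (quantumClass w α hα) (quantumClass w β hβ) =
              quantumClass w (quantumWedge w A h α β) hαβ) ∧
        (∀ (r s : ℤ), ∀ a ∈ classDegree (h := h) w hpow e r,
          ∀ b ∈ classDegree (h := h) w hpow e s, μ a b = ((-1 : ℝ) ^ (r * s)) • μ b a) ∧
        (∀ a b c, μ (μ a b) c = μ a (μ b c)) := by
  refine ⟨LinearMap.ext (quantumD_quantumD h hw), ?_⟩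
  have hcl : ∀ α β : QuantumForm m M A, quantumD w A h α = 0 → quantumD w A h β = 0 →
      quantumD w A h (quantumWedge w A h α β) = 0 := fun α β hα hβ => by
    rw [quantumD_quantumWedge h hw, hα, hβ, map_zero, map_zero, LinearMap.zero_apply, add_zero]
  have hrep : ∀ a : QuantumCohomology w A h, ∃ α hα, quantumClass w α hα = a := fun a => by
    obtain ⟨⟨α, hα⟩, rfl⟩ := Submodule.mkQ_surjective _ a
    exact ⟨α, hα, rfl⟩
  obtain ⟨μ, hμ⟩ := exists_product_of_leibniz (quantumD w A h) (quantumWedge w A h)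
    (quantumParity m M A) (quantumD_quantumWedge h hw)
    (quantumD_quantumParity h hw) quantumParity_quantumParity
  have hμ' : ∀ (α β : QuantumForm m M A) (hα : quantumD w A h α = 0) (hβ : quantumD w A h β = 0),
      μ (quantumClass w α hα) (quantumClass w β hβ) =
        quantumClass w (quantumWedge w A h α β) (hcl α β hα hβ) :=
    fun α β hα hβ => hμ α β hα hβ _
  have hcongr : ∀ {α β : QuantumForm m M A} (hα : quantumD w A h α = 0)
      (hβ : quantumD w A h β = 0), α = β → quantumClass w α hα = quantumClass w β hβ := by
    rintro α _ hα hβ rfl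
    rfl
  refine ⟨μ, ⟨fun α β hα hβ => ⟨hcl α β hα hβ, hμ' α β hα hβ⟩, ?_, ?_⟩, ?_⟩
  · rintro r s _ ⟨⟨α, hα⟩, hαr, rfl⟩ _ ⟨⟨β, hβ⟩, hβs, rfl⟩
    have hsup : quantumWedge w A h α β = (-1 : ℝ) ^ (r * s) • quantumWedge w A h β α :=
      quantumWedge_supercomm w h (quantumParity_of_mem_formDegree m M hαr)
      (quantumParity_of_mem_formDegree m M hβs)
    refine (hμ' α β hα hβ).trans (Eq.trans ?_ (congrArg _ (hμ' β α hβ hα).symm))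
    refine (hcongr _ ?_ hsup).trans rfl
    rw [map_smul, hcl β α hβ hα, smul_zero]
  · intro a b c
    obtain ⟨α, hα, rfl⟩ := hrep a
    obtain ⟨β, hβ, rfl⟩ := hrep b
    obtain ⟨γ, hγ, rfl⟩ := hrep c
    rw [hμ', hμ', hμ', hμ']
    exact hcongr _ _ (quantumWedge_assoc w h α β γ)
  · rintro ν ⟨hν, -, -⟩
    refine LinearMap.ext₂ fun a b => ?_
    obtain ⟨α, hα, rfl⟩ := hrep a
    obtain ⟨β, hβ, rfl⟩ := hrep b
    obtain ⟨_, h1⟩ := hν α β hα hβ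
    rw [h1, hμ']

end Cohomology

end QuantumDeRham

end

theorem mainTheorem3 {m : ℕ} {M : Type*} [TopologicalSpace M]
    [ChartedSpace (EuclideanSpace ℝ (Fin m)) M] [IsManifold (𝓡 m) ∞ M]
    (w : QuantumDeRham.BivectorField m M) (hw : w.IsPoisson) :
    -- the polynomial version, with coefficients in `ℝ[h]`
    (QuantumDeRham.quantumD w (Polynomial ℝ) Polynomial.X ∘ₗ
        QuantumDeRham.quantumD w (Polynomial ℝ) Polynomial.X = 0 ∧
      ∃! μ : QuantumDeRham.QuantumCohomology w (Polynomial ℝ) Polynomial.X →ₗ[ℝ]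
          QuantumDeRham.QuantumCohomology w (Polynomial ℝ) Polynomial.X →ₗ[ℝ]
            QuantumDeRham.QuantumCohomology w (Polynomial ℝ) Polynomial.X,
        (∀ (α β : QuantumDeRham.QuantumForm m M (Polynomial ℝ))
          (hα : QuantumDeRham.quantumD w (Polynomial ℝ) Polynomial.X α = 0)
          (hβ : QuantumDeRham.quantumD w (Polynomial ℝ) Polynomial.X β = 0),
          ∃ hαβ : QuantumDeRham.quantumD w (Polynomial ℝ) Polynomial.X
              (QuantumDeRham.quantumWedge w (Polynomial ℝ) Polynomial.X α β) = 0,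
            μ (QuantumDeRham.quantumClass w α hα) (QuantumDeRham.quantumClass w β hβ) =
              QuantumDeRham.quantumClass w
                (QuantumDeRham.quantumWedge w (Polynomial ℝ) Polynomial.X α β) hαβ) ∧
        (∀ (r s : ℤ),
          ∀ a ∈ QuantumDeRham.classDegree (A := Polynomial ℝ) (h := Polynomial.X) w
            (fun p : ℕ => Polynomial.X ^ p) (fun p : ℕ => (p : ℤ)) r,
          ∀ b ∈ QuantumDeRham.classDegree (A := Polynomial ℝ) (h := Polynomial.X) w
            (fun p : ℕ => Polynomial.X ^ p) (fun p : ℕ => (p : ℤ)) s,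
            μ a b = ((-1 : ℝ) ^ (r * s)) • μ b a) ∧
        (∀ a b c, μ (μ a b) c = μ a (μ b c))) ∧
    -- the Laurent version, with coefficients in `ℝ[h, h⁻¹]`
    (QuantumDeRham.quantumD w (LaurentPolynomial ℝ) (LaurentPolynomial.T 1) ∘ₗ
        QuantumDeRham.quantumD w (LaurentPolynomial ℝ) (LaurentPolynomial.T 1) = 0 ∧
      ∃! μ : QuantumDeRham.QuantumCohomology w (LaurentPolynomial ℝ) (LaurentPolynomial.T 1) →ₗ[ℝ]
          QuantumDeRham.QuantumCohomology w (LaurentPolynomial ℝ) (LaurentPolynomial.T 1) →ₗ[ℝ]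
            QuantumDeRham.QuantumCohomology w (LaurentPolynomial ℝ) (LaurentPolynomial.T 1),
        (∀ (α β : QuantumDeRham.QuantumForm m M (LaurentPolynomial ℝ))
          (hα : QuantumDeRham.quantumD w (LaurentPolynomial ℝ) (LaurentPolynomial.T 1) α = 0)
          (hβ : QuantumDeRham.quantumD w (LaurentPolynomial ℝ) (LaurentPolynomial.T 1) β = 0),
          ∃ hαβ : QuantumDeRham.quantumD w (LaurentPolynomial ℝ) (LaurentPolynomial.T 1)
              (QuantumDeRham.quantumWedge w (LaurentPolynomial ℝ) (LaurentPolynomial.T 1) α β) = 0,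
            μ (QuantumDeRham.quantumClass w α hα) (QuantumDeRham.quantumClass w β hβ) =
              QuantumDeRham.quantumClass w
                (QuantumDeRham.quantumWedge w (LaurentPolynomial ℝ) (LaurentPolynomial.T 1) α β)
                hαβ) ∧
        (∀ (r s : ℤ),
          ∀ a ∈ QuantumDeRham.classDegree (A := LaurentPolynomial ℝ) (h := LaurentPolynomial.T 1) w
            (fun p : ℤ => LaurentPolynomial.T p) (fun p : ℤ => p) r,
          ∀ b ∈ QuantumDeRham.classDegree (A := LaurentPolynomial ℝ) (h := LaurentPolynomial.T 1) w
            (fun p : ℤ => LaurentPolynomial.T p) (fun p : ℤ => p) s,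
            μ a b = ((-1 : ℝ) ^ (r * s)) • μ b a) ∧
        (∀ a b c, μ (μ a b) c = μ a (μ b c))) :=
  ⟨QuantumDeRham.quantumCohomology_product Polynomial.X hw (fun p : ℕ => Polynomial.X ^ p)
      (fun p : ℕ => (p : ℤ)),
    QuantumDeRham.quantumCohomology_product (LaurentPolynomial.T 1) hw
      (fun p : ℤ => LaurentPolynomial.T p) (fun p : ℤ => p)⟩
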